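/- All graphs are 1-dimensional, locally finite CW complexes such that the closure of each 1-cell is homeomorphic to $[-1,1]$ (multiple edges are allowed, loops are not); the vertices are the $0$-cells and the edges are the $1$-cells. A graph is infinite if it is not a finite CW complex. Two graphs are isomorphic if there is a homeomorphism between them that maps vertices onto vertices and edges onto edges. For a function $c\colon X\to\mathbb R$ on a topological space, a contour of $c$ is a connected component of a level set $c^{-1}(t)$, the Reeb space $R_c$ is the set of all contours of $c$ with the quotient topology, and $q_c\colon X\to R_c$ is the quotient map. If $X$ is a smooth manifold without boundary and $c$ is smooth, a contour is called critical if it contains a critical point of $c$ and regular otherwise; $R_c$ is said to be the Reeb graph of $c$ if it carries the structure of a graph whose vertex set consists exactly of the points representing critical contours. Theorem. There exists a connected infinite graph $G_1$ such that, for every integer $m>1$, the following holds. Let $e_m\colon\mathbb R^{m+1}\to\mathbb R$ be the function $$e_m(x_1,x_2,y_1,\dots,y_{m-1})=\Bigl(x_1-\frac{\sin^2 x_2}{2(x_2^2+1)}\Bigr)\Bigl(\frac1{x_2^2+1}-x_1\Bigr)-\sum_{j=1}^{m-1}y_j^2,$$ let $X_m=e_m^{-1}(0)$, and let $c_m\colon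 X_m\to\mathbb R$ be the restriction of the projection to the first coordinate $x_1$. Then: 1. $e_m$ is real analytic, and $X_m$ is a non-compact, connected, smooth $m$-dimensional submanifold of $\mathbb R^{m+1}$ (so that $c_m$ is a smooth function); 2. the Reeb space $R_{c_m}$ is the Reeb graph of $c_m$, and this graph is isomorphic to $G_1$; 3. the quotient map $q_{c_m}\colon X_m\to R_{c_m}$ is proper (preimages of compact sets are compact), and every regular contour of $c_m$ is diffeomorphic to the sphere $S^{m-1}$. -/

import Mathlib

open Set Topology Manifold
open scoped ContDiff

noncomputable section

namespace Reeb

/-! ### Reeb spaces -/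

section ReebSpace

variable {X Y : Type*} [TopologicalSpace X]

/-- The contour of `c` through `x`: the connected component containing `x` of the level set
`c ⁻¹ (c x)`. Every contour of `c` is of this form. -/
def contour (c : X → Y) (x : X) : Set X :=
  connectedComponentIn (c ⁻¹' {c x}) x

theorem mem_contour_self (c : X → Y) (x : X) : x ∈ contour c x :=
  mem_connectedComponentIn rfl

theorem contour_eq_of_mem {c : X → Y} {x y : X} (h : y ∈ contour c x) :
    contour c y = contour c x := by
  have hc : c y = c x := connectedComponentIn_subset (c ⁻¹' {c x}) x h
  unfold contour at h ⊢
  rw [hc]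
  exact (connectedComponentIn_eq h).symm

/-- Two points are equivalent when they lie in the same connected component of a level set. -/
def contourSetoid (c : X → Y) : Setoid X where
  r x y := y ∈ contour c x
  iseqv :=
    { refl := mem_contour_self c
      symm := fun {x y} h => by rw [contour_eq_of_mem h]; exact mem_contour_self c x
      trans := fun {x y z} h h' => by rwa [contour_eq_of_mem h] at h' }

/-- The Reeb space of `c`, the space of all contours of `c` with the quotient topology. -/
abbrev ReebSpace (c : X → Y) : Type _ := Quotient (contourSetoid c)

/-- The quotient map onto the Reeb space. -/
def quotientMap (c : X → Y) : X → ReebSpace c := Quotient.mk (contourSetoid c)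

end ReebSpace

/-! ### Graphs as one-dimensional CW complexes -/

section Graph

/-- The set of all (open) `n`-cells of a CW complex. -/
def openCells (G : Type*) [TopologicalSpace G] [CWComplex (univ : Set G)] (n : ℕ) :
    Set (Set G) :=
  range fun i : RelCWComplex.cell (univ : Set G) n => RelCWComplex.openCell n i

/-- The set of vertices (the points which are `0`-cells). -/
def vertexSet (G : Type*) [TopologicalSpace G] [CWComplex (univ : Set G)] : Set G :=
  ⋃₀ openCells G 0

/-- A graph: a one-dimensional, locally finite (Hausdorff) CW complex such that the closure of
each `1`-cell is homeomorphic to `[-1, 1]`. Multiple edges are allowed, loops are not. -/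
structure IsGraph (G : Type*) [TopologicalSpace G] [CWComplex (univ : Set G)] : Prop where
  t2 : T2Space G
  nonempty_edge : (openCells G 1).Nonempty
  isEmpty_cell : ∀ n, 1 < n → IsEmpty (RelCWComplex.cell (univ : Set G) n)
  locallyFinite : LocallyFinite
    fun p : Σ n, RelCWComplex.cell (univ : Set G) n => RelCWComplex.closedCell p.1 p.2
  closure_edge : ∀ e ∈ openCells G 1, Nonempty (closure e ≃ₜ Icc (-1 : ℝ) 1)

/-- An infinite graph: a graph which is not a finite CW complex. -/
structure IsInfiniteGraph (G : Type*) [TopologicalSpace G] [CWComplex (univ : Set G)] : Prop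
    extends IsGraph G where
  not_finite : ¬ RelCWComplex.Finite (univ : Set G)

/-- Two graphs are isomorphic when there is a homeomorphism between them which maps the vertices
onto the vertices and the edges onto the edges. -/
def GraphIsomorphic (G H : Type*) [TopologicalSpace G] [CWComplex (univ : Set G)]
    [TopologicalSpace H] [CWComplex (univ : Set H)] : Prop :=
  ∃ φ : G ≃ₜ H, ∀ n, (fun e : Set G => φ '' e) '' openCells G n = openCells H n

end Graph

/-! ### Smooth functions on manifolds: critical points, Reeb graphs, spheres -/

section Smooth

variable {m : ℕ} {M : Type*} [TopologicalSpace M] [ChartedSpace (EuclideanSpace ℝ (Fin m)) M]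

/-- The set of critical points of a (smooth) real-valued function on an `m`-manifold. -/
def criticalPoints (c : M → ℝ) : Set M :=
  {x | mfderiv (𝓡 m) 𝓘(ℝ, ℝ) c x = 0}

/-- A set of points (such as a contour) is regular when it contains no critical point. -/
def IsRegularSet (c : M → ℝ) (C : Set M) : Prop :=
  ∀ y ∈ C, y ∉ criticalPoints (m := m) c

/-- A CW structure on the Reeb space of `c` is the Reeb graph of `c` when it is a graph and its
vertices are exactly the points which represent contours containing critical points. -/
structure IsReebGraph (c : M → ℝ) [CWComplex (univ : Set (ReebSpace c))] : Prop where
  isGraph : IsGraph (ReebSpace c)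
  vertexSet_eq : vertexSet (ReebSpace c) = quotientMap c '' criticalPoints (m := m) c

/-- A subset `C` of a manifold is diffeomorphic to the unit sphere `S^k ⊂ ℝ^(k+1)`, that is, it
is the image of a smooth embedding of `S^k`. -/
def IsDiffeomorphicToSphere (k : ℕ) (C : Set M) : Prop :=
  ∃ f : Metric.sphere (0 : EuclideanSpace ℝ (Fin (k + 1))) 1 → M,
    IsSmoothEmbedding (𝓡 k) (𝓡 m) ∞ f ∧ range f = C

end Smooth

/-! ### The explicit functions and hypersurfaces -/

/-- The function `(x₁ - sin² x₂ / (2 (x₂² + 1))) (1 / (x₂² + 1) - x₁) - ∑ yⱼ²` on `ℝ^(m+1)`, with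
coordinates `(x₁, x₂, y₁, …, y_{m-1})`. -/
def definingFun (m : ℕ) (x : EuclideanSpace ℝ (Fin (m + 1))) : ℝ :=
  (x 0 - Real.sin (x 1) ^ 2 / (2 * (x 1 ^ 2 + 1))) * (1 / (x 1 ^ 2 + 1) - x 0)
    - ∑ j : Fin (m + 1) with 2 ≤ j.val, x j ^ 2

/-- The zero set of `definingFun m`. -/
def zeroSet (m : ℕ) : Set (EuclideanSpace ℝ (Fin (m + 1))) := {x | definingFun m x = 0}

/-- The restriction to `zeroSet m` of the projection to the first coordinate. -/
def firstCoord (m : ℕ) : zeroSet m → ℝ := fun x => x.1 0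

end Reeb

end

/-!
For fixed `x₁ = s` and `x₂ = t` the points of the hypersurface form a sphere of squared radius
`(s - lower t) * (upper t - s)`, so up to these spheres the hypersurface is the planar region
between the curves `lower` and `upper`. In the slice of the region at level `s`, two points lie in
the same component exactly when `lower` does not exceed `s` between them, that is, when the
integral of the excess of `lower` over `s` does not separate them. Recording `s` with this integral
maps the hypersurface properly onto a planar tree that does not depend on the dimension, and the
fibres of this map are the contours; hence the tree is the Reeb space.

A contour is critical exactly when the squared radius has a multiple zero on the corresponding
component of the slice, that is, at the critical points of `lower` and at the maximum of `upper`.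
Between consecutive multiples of `π` the function `lower` has a single critical point, its maximum;
these maxima decrease and are the merging points of the tree. Over a regular contour `x₂` varies in
an interval at whose ends the squared radius vanishes to first order, which makes it a sphere.
-/

noncomputable section

namespace Reeb

section InverseFunction

variable {E F : Type*} [NormedAddCommGroup E] [NormedSpace ℝ E] [CompleteSpace E]
  [NormedAddCommGroup F] [NormedSpace ℝ F] {n : WithTop ℕ∞}

theorem exists_openPartialHomeomorph_contDiffOn_symm (hn : 1 ≤ n) {f : E → F} {U : Set E} {a : E}
    (hU : IsOpen U) (ha : a ∈ U) (hf : ContDiffOn ℝ n f U) (f' : E ≃L[ℝ] F)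
    (hf' : HasFDerivAt f (f' : E →L[ℝ] F) a) :
    ∃ e : OpenPartialHomeomorph E F, (e : E → F) = f ∧ a ∈ e.source ∧ e.source ⊆ U ∧
      ContDiffOn ℝ n e.symm e.target := by
  have hn₀ : n ≠ 0 := (zero_lt_one.trans_le hn).ne'
  have hfU {x : E} (hx : x ∈ U) : ContDiffAt ℝ n f x := hf.contDiffAt (hU.mem_nhds hx)
  -- Shrink `U` so that the derivative is invertible, hence `f` a local diffeomorphism, throughout.
  let V : Set E := U ∩ fderiv ℝ f ⁻¹' range ((↑) : (E ≃L[ℝ] F) → E →L[ℝ] F)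
  have hV : IsOpen V :=
    (hf.continuousOn_fderiv_of_isOpen hU hn).isOpen_inter_preimage hU ContinuousLinearEquiv.isOpen
  let e := ((hfU ha).toOpenPartialHomeomorph f hf' hn₀).restrOpen V hV
  refine ⟨e, rfl, ⟨(hfU ha).mem_toOpenPartialHomeomorph_source hf' hn₀, ha, f', hf'.fderiv.symm⟩,
    fun x hx ↦ hx.2.1, fun y hy ↦ ?_⟩
  obtain ⟨hyU, A, hA⟩ : e.symm y ∈ V := (e.map_target hy).2
  refine (e.contDiffAt_symm (f₀' := A) hy ?_ (hfU hyU)).contDiffWithinAt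
  rw [hA]
  exact ((hfU hyU).differentiableAt hn₀).hasFDerivAt

end InverseFunction

section Immersion

variable {E K W M N : Type*} [NormedAddCommGroup E] [NormedSpace ℝ E]
  [NormedAddCommGroup K] [NormedSpace ℝ K] [NormedAddCommGroup W] [NormedSpace ℝ W]
  [TopologicalSpace M] [ChartedSpace K M] [TopologicalSpace N] [ChartedSpace E N]
  {n : WithTop ℕ∞} {f : M → N} {x : M}

theorem injective_mfderiv_of_isImmersionAtOfComplement [IsManifold 𝓘(ℝ, K) n M]
    [IsManifold 𝓘(ℝ, E) n N] (hn : 1 ≤ n)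
    (hf : IsImmersionAtOfComplement W 𝓘(ℝ, K) 𝓘(ℝ, E) n f x) :
    Function.Injective (mfderiv 𝓘(ℝ, K) 𝓘(ℝ, E) f x) := by
  have hn₀ : n ≠ 0 := (zero_lt_one.trans_le hn).ne'
  -- An immersion has a differentiable local left inverse `g`, namely a projection in charts.
  let p : N → K := fun y ↦ (hf.equiv.symm (hf.codChart y)).1
  let g : N → M := hf.domChart.symm ∘ p
  have hpf : ∀ y ∈ hf.domChart.source, p (f y) = hf.domChart y := fun y hy ↦ by
    have hmem : hf.domChart y ∈ (hf.domChart.extend 𝓘(ℝ, K)).target := by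
      simpa using hf.domChart.map_source hy
    have hψ : hf.codChart (f y) = hf.equiv (hf.domChart y, 0) := by
      simpa [hf.domChart.left_inv hy] using hf.writtenInCharts hmem
    simp [p, hψ]
  have hgf : g ∘ f =ᶠ[𝓝 x] id := by
    filter_upwards [hf.domChart.open_source.mem_nhds hf.mem_domChart_source] with y hy
    simp only [g, Function.comp_apply, hpf y hy, hf.domChart.left_inv hy, id]
  have hp : MDifferentiableAt 𝓘(ℝ, E) 𝓘(ℝ, K) p (f x) := by
    have hψ := (contMDiffAt_of_mem_maximalAtlas hf.codChart_mem_maximalAtlas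
      hf.mem_codChart_source).mdifferentiableAt hn₀
    have hfst : ContDiff ℝ 1 fun v : E ↦ (hf.equiv.symm v).1 := by fun_prop
    exact (hfst.contMDiff.mdifferentiable one_ne_zero _).comp (f x) hψ
  have hg : MDifferentiableAt 𝓘(ℝ, E) 𝓘(ℝ, K) g (f x) := by
    refine MDifferentiableAt.comp (f x) ?_ hp
    rw [hpf x hf.mem_domChart_source]
    exact (contMDiffAt_symm_of_mem_maximalAtlas hf.domChart_mem_maximalAtlas
      (hf.domChart.map_source hf.mem_domChart_source)).mdifferentiableAt hn₀
  have hcomp : (mfderiv 𝓘(ℝ, E) 𝓘(ℝ, K) g (f x)).comp (mfderiv 𝓘(ℝ, K) 𝓘(ℝ, E) f x) =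
      ContinuousLinearMap.id ℝ (TangentSpace 𝓘(ℝ, K) x) := by
    rw [← mfderiv_comp x hg (hf.contMDiffAt.mdifferentiableAt hn₀), hgf.mfderiv_eq, mfderiv_id]
  exact Function.LeftInverse.injective fun v ↦ congr($hcomp v)

end Immersion

section StraighteningImmersions

theorem mem_contDiffGroupoid_of_contDiffOn {E : Type*} [NormedAddCommGroup E] [NormedSpace ℝ E]
    {n : WithTop ℕ∞} {e : OpenPartialHomeomorph E E} (he : ContDiffOn ℝ n e e.source)
    (he' : ContDiffOn ℝ n e.symm e.target) : e ∈ contDiffGroupoid n 𝓘(ℝ, E) := by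
  rw [contDiffGroupoid, mem_groupoid_of_pregroupoid]
  simpa [contDiffPregroupoid] using ⟨he, he'⟩

theorem trans_mem_maximalAtlas {H M : Type*} [TopologicalSpace H] [TopologicalSpace M]
    [ChartedSpace H M] {G : StructureGroupoid H} {e : OpenPartialHomeomorph M H}
    {κ : OpenPartialHomeomorph H H} (he : e ∈ G.maximalAtlas M) (hκ : κ ∈ G) :
    e ≫ₕ κ ∈ G.maximalAtlas M := by
  rw [mem_maximalAtlas_iff] at he ⊢
  intro e' he'
  constructor
  · rw [OpenPartialHomeomorph.trans_symm_eq_symm_trans_symm, OpenPartialHomeomorph.trans_assoc]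
    exact G.trans (G.symm hκ) (he e' he').1
  · rw [← OpenPartialHomeomorph.trans_assoc]
    exact G.trans (he e' he').2 hκ

variable {E K : Type*} (W : Type*) [NormedAddCommGroup E] [NormedSpace ℝ E] [FiniteDimensional ℝ E]
  [NormedAddCommGroup K] [NormedSpace ℝ K] [FiniteDimensional ℝ K]
  [NormedAddCommGroup W] [NormedSpace ℝ W] [FiniteDimensional ℝ W]

theorem exists_prod_equiv_apply_inl
    (hdim : Module.finrank ℝ K + Module.finrank ℝ W = Module.finrank ℝ E)
    (B : K →L[ℝ] E) (hB : Function.Injective B) :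
    ∃ T : (K × W) ≃L[ℝ] E, ∀ u, T (u, 0) = B u := by
  obtain ⟨V, hV⟩ := Submodule.exists_isCompl (LinearMap.range B.toLinearMap)
  have hrank : Module.finrank ℝ (LinearMap.range B.toLinearMap) = Module.finrank ℝ K :=
    LinearMap.finrank_range_of_inj hB
  have hWV : Module.finrank ℝ W = Module.finrank ℝ V := by
    have := Submodule.finrank_add_eq_of_isCompl hV
    omega
  let T : (K × W) ≃ₗ[ℝ] E :=
    ((LinearEquiv.ofInjective B.toLinearMap hB).prodCongr (.ofFinrankEq _ _ hWV)).trans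
      (Submodule.prodEquivOfIsCompl _ _ hV)
  exact ⟨T.toContinuousLinearEquiv, fun u ↦ show T (u, 0) = B u by simp [T]⟩

variable {n : WithTop ℕ∞}

theorem exists_contDiffGroupoid_apply_eq_of_injective_fderiv (hn : 1 ≤ n)
    (hdim : Module.finrank ℝ K + Module.finrank ℝ W = Module.finrank ℝ E)
    {g : K → E} {U : Set K} {a : K} (hU : IsOpen U) (ha : a ∈ U) (hg : ContDiffOn ℝ n g U)
    (hinj : Function.Injective (fderiv ℝ g a)) :
    ∃ (T : (K × W) ≃L[ℝ] E) (κ : OpenPartialHomeomorph E E) (V : Set K),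
      κ ∈ contDiffGroupoid n 𝓘(ℝ, E) ∧ IsOpen V ∧ a ∈ V ∧
        ∀ u ∈ V, g u ∈ κ.source ∧ κ (g u) = T (u, 0) := by
  obtain ⟨T, hT⟩ := exists_prod_equiv_apply_inl W hdim (fderiv ℝ g a) hinj
  -- `G` extends `g` by a linear complement of the image of its derivative.
  let G : K × W → E := fun p ↦ g p.1 + T (0, p.2)
  have hG : ContDiffOn ℝ n G (U ×ˢ univ) :=
    (hg.comp contDiff_fst.contDiffOn fun p hp ↦ hp.1).add (ContDiff.contDiffOn (by fun_prop))
  have hG' : HasFDerivAt G (T : K × W →L[ℝ] E) (a, 0) := by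
    have h₁ : HasFDerivAt g (fderiv ℝ g a) ((a, (0 : W)).1) :=
      ((hg.contDiffAt (hU.mem_nhds ha)).differentiableAt
        (zero_lt_one.trans_le hn).ne').hasFDerivAt
    have h₂ := ((T : K × W →L[ℝ] E).comp (ContinuousLinearMap.inr ℝ K W)).hasFDerivAt.comp
      (a, (0 : W)) hasFDerivAt_snd
    refine ((h₁.comp (a, (0 : W)) hasFDerivAt_fst).add h₂).congr_fderiv ?_
    ext p <;> simp [hT]
  have : CompleteSpace (K × W) := FiniteDimensional.complete ℝ _
  obtain ⟨e, heG, hae, heU, he⟩ := exists_openPartialHomeomorph_contDiffOn_symm hn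
    (hU.prod isOpen_univ) (mk_mem_prod ha (mem_univ _)) hG T hG'
  have heg : ∀ u, e (u, 0) = g u := fun u ↦ by simp [heG, G]
  refine ⟨T, e.symm ≫ₕ T.toHomeomorph.toOpenPartialHomeomorph, (fun u ↦ (u, 0)) ⁻¹' e.source,
    mem_contDiffGroupoid_of_contDiffOn ?_ ?_, e.open_source.preimage (by fun_prop), hae,
    fun u hu ↦ ⟨⟨heg u ▸ e.map_source hu, mem_univ _⟩, congrArg T ?_⟩⟩
  · exact (T.contDiff.comp_contDiffOn he).mono fun y hy ↦ hy.1
  · exact (heG ▸ hG.mono heU).comp (t := e.source) T.symm.contDiff.contDiffOn fun y hy ↦ hy.2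
  · rw [← heg]
    exact e.left_inv hu

variable {M N : Type*} [TopologicalSpace M] [ChartedSpace K M] [IsManifold 𝓘(ℝ, K) n M]
  [TopologicalSpace N] [ChartedSpace E N] [IsManifold 𝓘(ℝ, E) n N]

theorem isImmersionAtOfComplement_of_injective_mfderiv (hn : 1 ≤ n)
    (hdim : Module.finrank ℝ K + Module.finrank ℝ W = Module.finrank ℝ E)
    {f : M → N} (hf : ContMDiff 𝓘(ℝ, K) 𝓘(ℝ, E) n f) {x : M}
    (hx : Function.Injective (mfderiv 𝓘(ℝ, K) 𝓘(ℝ, E) f x)) :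
    IsImmersionAtOfComplement W 𝓘(ℝ, K) 𝓘(ℝ, E) n f x := by
  let φ := chartAt K x
  let ψ := chartAt E (f x)
  let g : K → E := fun u ↦ ψ (f (φ.symm u))
  let U : Set K := φ.target ∩ φ.symm ⁻¹' (f ⁻¹' ψ.source)
  have hxφ : x ∈ φ.source := mem_chart_source K x
  have hg : ContDiffOn ℝ n g U := by
    have h := (contMDiff_iff.1 hf).2 x (f x)
    simp only [mfld_simps] at h
    exact h
  have hg' : fderiv ℝ g (φ x) = mfderiv 𝓘(ℝ, K) 𝓘(ℝ, E) f x := by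
    rw [((hf x).mdifferentiableAt (zero_lt_one.trans_le hn).ne').mfderiv]
    simp only [modelWithCornersSelf_coe, range_id, fderivWithin_univ]
    rfl
  have hφU : φ x ∈ U := ⟨φ.map_source hxφ, by
    rw [mem_preimage, φ.left_inv hxφ]
    exact mem_chart_source E (f x)⟩
  obtain ⟨T, κ, V, hκ, hV, hφV, hκg⟩ := exists_contDiffGroupoid_apply_eq_of_injective_fderiv W hn
    hdim (φ.isOpen_inter_preimage_symm (ψ.open_source.preimage hf.continuous)) hφU hg
    (by rw [hg']; exact hx)
  have hφV' : IsOpen (φ.source ∩ φ ⁻¹' V) := φ.isOpen_inter_preimage hV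
  refine IsImmersionAtOfComplement.mk_of_continuousAt hf.continuous.continuousAt T
    (φ.restr (φ.source ∩ φ ⁻¹' V)) (ψ ≫ₕ κ) ?_ ?_ ?_ ?_ fun u hu ↦ ?_
  · rw [φ.restr_source, hφV'.interior_eq]
    exact ⟨hxφ, hxφ, hφV⟩
  · have hgκ : ψ (f (φ.symm (φ x))) ∈ κ.source := (hκg (φ x) hφV).1
    rw [φ.left_inv hxφ] at hgκ
    exact ⟨mem_chart_source E (f x), hgκ⟩
  · exact restr_mem_maximalAtlas (contDiffGroupoid n 𝓘(ℝ, K))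
      (IsManifold.chart_mem_maximalAtlas (I := 𝓘(ℝ, K)) x) hφV'
  · exact trans_mem_maximalAtlas (IsManifold.chart_mem_maximalAtlas (I := 𝓘(ℝ, E)) (f x)) hκ
  · have huφ : u ∈ (φ.restr (φ.source ∩ φ ⁻¹' V)).target := by simpa using hu
    have huV : u ∈ V := by
      simpa only [mem_preimage, φ.right_inv huφ.1] using (interior_subset huφ.2).2
    exact (hκg u huV).2

theorem isSmoothEmbedding_of_injective_mfderiv [CompactSpace M] [T2Space N] (hn : 1 ≤ n)
    (hdim : Module.finrank ℝ K + Module.finrank ℝ W = Module.finrank ℝ E) {f : M → N}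
    (hf : ContMDiff 𝓘(ℝ, K) 𝓘(ℝ, E) n f) (hinj : Function.Injective f)
    (hdf : ∀ x, Function.Injective (mfderiv 𝓘(ℝ, K) 𝓘(ℝ, E) f x)) :
    IsSmoothEmbedding 𝓘(ℝ, K) 𝓘(ℝ, E) n f where
  isImmersion := IsImmersionOfComplement.isImmersion (F := W) fun x ↦
    isImmersionAtOfComplement_of_injective_mfderiv W hn hdim hf (hdf x)
  isEmbedding := (hf.continuous.isClosedEmbedding hinj).isEmbedding

end StraighteningImmersions

theorem injective_mfderiv_of_comp {𝕜 : Type*} [NontriviallyNormedField 𝕜]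
    {E H M E' H' M' E'' H'' M'' : Type*} [NormedAddCommGroup E] [NormedSpace 𝕜 E]
    [TopologicalSpace H] {I : ModelWithCorners 𝕜 E H} [TopologicalSpace M] [ChartedSpace H M]
    [NormedAddCommGroup E'] [NormedSpace 𝕜 E'] [TopologicalSpace H']
    {I' : ModelWithCorners 𝕜 E' H'} [TopologicalSpace M'] [ChartedSpace H' M']
    [NormedAddCommGroup E''] [NormedSpace 𝕜 E''] [TopologicalSpace H'']
    {I'' : ModelWithCorners 𝕜 E'' H''} [TopologicalSpace M''] [ChartedSpace H'' M'']
    {f : M → M'} {g : M' → M''} {x : M} (hg : MDifferentiableAt I' I'' g (f x))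
    (hf : MDifferentiableAt I I' f x) (h : Function.Injective (mfderiv I I'' (g ∘ f) x)) :
    Function.Injective (mfderiv I I' f x) := by
  rw [mfderiv_comp x hg hf] at h
  exact Function.Injective.of_comp h

section RegularLevelSet

variable {E K W V : Type*} [NormedAddCommGroup E] [NormedSpace ℝ E]
  [NormedAddCommGroup K] [NormedSpace ℝ K] [NormedAddCommGroup W] [NormedSpace ℝ W]
  [NormedAddCommGroup V] [NormedSpace ℝ V]

/-- A local diffeomorphism of `E` with `K × W` near `x` whose second component is `F` and whose
first component is linear. It straightens the level sets of `F` to the slices `K × {w}`. -/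
structure Straightening (K : Type*) [NormedAddCommGroup K] [NormedSpace ℝ K] (F : E → W)
    (x : E) where
  lin : E ≃L[ℝ] K × W
  equiv : OpenPartialHomeomorph E (K × W)
  mem_source : x ∈ equiv.source
  coe_equiv : ∀ y, equiv y = ((lin y).1, F y)
  contDiffOn_symm : ContDiffOn ℝ ∞ equiv.symm equiv.target

namespace Straightening

variable {F : E → W} {x : E} (Φ : Straightening K F x)

theorem apply_equiv_symm_eq_zero {v : K} (hv : (v, (0 : W)) ∈ Φ.equiv.target) :
    F (Φ.equiv.symm (v, 0)) = 0 := by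
  have h := Φ.equiv.right_inv hv
  rw [Φ.coe_equiv] at h
  exact congrArg Prod.snd h

open Classical in
/-- The chart of the zero set of `F` induced by a straightening. Outside the image of the chart,
its inverse takes the junk value `x`. -/
def chart (hx : F x = 0) : OpenPartialHomeomorph {y | F y = 0} K where
  toFun y := (Φ.lin y).1
  invFun v := if hv : (v, (0 : W)) ∈ Φ.equiv.target
    then ⟨Φ.equiv.symm (v, 0), Φ.apply_equiv_symm_eq_zero hv⟩ else ⟨x, hx⟩
  source := Subtype.val ⁻¹' Φ.equiv.source
  target := (fun v ↦ (v, (0 : W))) ⁻¹' Φ.equiv.target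
  map_source' y hy := by
    have h := Φ.equiv.map_source hy
    rwa [Φ.coe_equiv, y.2] at h
  map_target' v hv := by
    rw [mem_preimage] at hv
    rw [dif_pos hv]
    exact Φ.equiv.map_target hv
  left_inv' y hy := by
    have hmem := Φ.equiv.map_source hy
    have hinv := Φ.equiv.left_inv hy
    rw [Φ.coe_equiv, y.2] at hmem hinv
    rw [dif_pos hmem]
    exact Subtype.ext hinv
  right_inv' v hv := by
    rw [mem_preimage] at hv
    have hinv := Φ.equiv.right_inv hv
    rw [Φ.coe_equiv] at hinv
    rw [dif_pos hv]
    exact congrArg Prod.fst hinv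
  open_source := Φ.equiv.open_source.preimage continuous_subtype_val
  open_target := Φ.equiv.open_target.preimage (by fun_prop)
  continuousOn_toFun := by fun_prop
  continuousOn_invFun := by
    rw [Topology.IsEmbedding.subtypeVal.isInducing.continuousOn_iff]
    refine (Φ.equiv.continuousOn_symm.comp (f := fun v : K ↦ (v, (0 : W))) (by fun_prop)
      fun v hv ↦ hv).congr fun v hv ↦ ?_
    exact congrArg Subtype.val (dif_pos hv)

theorem coe_chart_symm_apply (hx : F x = 0) {v : K} (hv : v ∈ (Φ.chart hx).target) :
    ((Φ.chart hx).symm v : E) = Φ.equiv.symm (v, 0) :=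
  congrArg Subtype.val (dif_pos (show (v, (0 : W)) ∈ Φ.equiv.target from hv))

theorem contDiffOn_coe_chart_symm (hx : F x = 0) :
    ContDiffOn ℝ ∞ (fun v ↦ ((Φ.chart hx).symm v : E)) (Φ.chart hx).target :=
  (Φ.contDiffOn_symm.comp (f := fun v : K ↦ (v, (0 : W))) (by fun_prop)
    fun v hv ↦ hv).congr fun _ hv ↦ Φ.coe_chart_symm_apply hx hv

end Straightening

variable [FiniteDimensional ℝ E] [FiniteDimensional ℝ K] [FiniteDimensional ℝ W]

theorem exists_equiv_prod_snd_eq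
    (hdim : Module.finrank ℝ K + Module.finrank ℝ W = Module.finrank ℝ E)
    (l : E →L[ℝ] W) (hl : Function.Surjective l) : ∃ A : E ≃L[ℝ] K × W, ∀ v, (A v).2 = l v := by
  obtain ⟨r, hr⟩ := l.exists_rightInverse_of_surjective (LinearMap.range_eq_top.2 hl)
  have hright : Function.RightInverse r l := fun w ↦ congr($hr w)
  have hker : Module.finrank ℝ l.ker = Module.finrank ℝ K := by
    have hrank := l.toLinearMap.finrank_range_add_finrank_ker
    rw [LinearMap.range_eq_top.2 hl, finrank_top, ← hdim, add_comm, Nat.add_right_cancel_iff]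
      at hrank
    exact hrank
  let e : l.ker ≃L[ℝ] K := ContinuousLinearEquiv.ofFinrankEq hker
  exact ⟨(ContinuousLinearEquiv.equivOfRightInverse l r hright).trans
    ((ContinuousLinearEquiv.prodComm ℝ W l.ker).trans
      (e.prodCongr (ContinuousLinearEquiv.refl ℝ W))), fun v ↦ rfl⟩

theorem nonempty_straightening
    (hdim : Module.finrank ℝ K + Module.finrank ℝ W = Module.finrank ℝ E) {F : E → W}
    (hF : ContDiff ℝ ∞ F) {x : E} (hx : Function.Surjective (fderiv ℝ F x)) :
    Nonempty (Straightening K F x) := by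
  obtain ⟨A, hA⟩ := exists_equiv_prod_snd_eq hdim (fderiv ℝ F x) hx
  let P : E →L[ℝ] K := (ContinuousLinearMap.fst ℝ K W).comp (A : E →L[ℝ] K × W)
  have hd : HasFDerivAt (fun y ↦ (P y, F y)) (A : E →L[ℝ] K × W) x := by
    refine (P.hasFDerivAt.prodMk (hF.differentiable (by simp) x).hasFDerivAt).congr_fderiv ?_
    ext v
    · simp [P]
    · simp [hA]
  have : CompleteSpace E := FiniteDimensional.complete ℝ E
  obtain ⟨e, he, hxe, -, hes⟩ := exists_openPartialHomeomorph_contDiffOn_symm (by simp)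
    isOpen_univ (mem_univ x) (P.contDiff.prodMk hF).contDiffOn A hd
  exact ⟨⟨A, e, hxe, fun y ↦ by rw [he]; rfl, hes⟩⟩

/-- The hypotheses of the regular value theorem: `F : E → W` is smooth and a submersion along its
zero set, so that this zero set is a manifold modelled on `K`, which has the right dimension. -/
structure IsRegularZero (K : Type*) [NormedAddCommGroup K] [NormedSpace ℝ K] (F : E → W) :
    Prop where
  finrank_add_finrank : Module.finrank ℝ K + Module.finrank ℝ W = Module.finrank ℝ E
  contDiff : ContDiff ℝ ∞ F
  surjective_fderiv : ∀ x, F x = 0 → Function.Surjective (fderiv ℝ F x)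

namespace IsRegularZero

variable {F : E → W} (hF : IsRegularZero K F)
include hF

/-- A choice of straightening at each point of the zero set. -/
def straightening (x : {y | F y = 0}) : Straightening K F (x : E) :=
  (nonempty_straightening hF.finrank_add_finrank hF.contDiff (hF.surjective_fderiv x x.2)).some

/-- The manifold structure on a regular zero set given by its straightenings. It is not an
instance, as it depends on the proof of regularity. -/
@[reducible]
def chartedSpace : ChartedSpace K {y | F y = 0} where
  atlas := range fun x : {y | F y = 0} ↦ (hF.straightening x).chart x.2
  chartAt x := (hF.straightening x).chart x.2
  mem_chart_source x := (hF.straightening x).mem_source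
  chart_mem_atlas := mem_range_self

theorem isManifold : @IsManifold ℝ _ K _ _ K _ 𝓘(ℝ, K) ∞ {y | F y = 0} _ hF.chartedSpace := by
  let _ := hF.chartedSpace
  apply isManifold_of_contDiffOn
  rintro _ _ ⟨x, rfl⟩ ⟨x', rfl⟩
  have hchart : ContDiff ℝ ∞ fun y : E ↦ ((hF.straightening x').lin y).1 := by fun_prop
  exact (hchart.comp_contDiffOn (((hF.straightening x).contDiffOn_coe_chart_symm x.2).mono
    fun v hv ↦ hv.1.1)).congr fun v _ ↦ rfl

theorem isImmersionAtOfComplement_val (x : {y | F y = 0}) :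
    let _ := hF.chartedSpace
    IsImmersionAtOfComplement W 𝓘(ℝ, K) 𝓘(ℝ, E) ∞ (Subtype.val : {y | F y = 0} → E) x := by
  let _ := hF.chartedSpace
  have := hF.isManifold
  let Φ := hF.straightening x
  refine IsImmersionAtOfComplement.mk_of_continuousAt continuousAt_subtype_val Φ.lin.symm
    (Φ.chart x.2) (Φ.equiv ≫ₕ Φ.lin.symm.toHomeomorph.toOpenPartialHomeomorph)
    Φ.mem_source ⟨Φ.mem_source, mem_univ _⟩ (IsManifold.chart_mem_maximalAtlas x)
    (StructureGroupoid.mem_maximalAtlas_of_mem_groupoid _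
      (mem_contDiffGroupoid_of_contDiffOn ?_ ?_)) fun v hv ↦ ?_
  · have hsmooth : ContDiff ℝ ∞ fun y ↦ Φ.lin.symm ((Φ.lin y).1, F y) := by
      have := hF.contDiff
      fun_prop
    exact hsmooth.contDiffOn.congr fun y _ ↦ congrArg Φ.lin.symm (Φ.coe_equiv y)
  · exact Φ.contDiffOn_symm.comp (t := Φ.equiv.target) Φ.lin.contDiff.contDiffOn fun y hy ↦ hy.2
  · have hv' : v ∈ (Φ.chart x.2).target := by simpa using hv
    change Φ.lin.symm (Φ.equiv ((Φ.chart x.2).symm v : E)) = Φ.lin.symm (v, 0)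
    rw [Φ.coe_chart_symm_apply x.2 hv', Φ.equiv.right_inv hv']

theorem isSmoothEmbedding_val :
    let _ := hF.chartedSpace
    IsSmoothEmbedding 𝓘(ℝ, K) 𝓘(ℝ, E) ∞ (Subtype.val : {y | F y = 0} → E) :=
  let _ := hF.chartedSpace
  ⟨IsImmersionOfComplement.isImmersion (F := W) hF.isImmersionAtOfComplement_val,
    IsEmbedding.subtypeVal⟩

theorem range_mfderiv_val (x : {y | F y = 0}) :
    let _ := hF.chartedSpace
    range (mfderiv 𝓘(ℝ, K) 𝓘(ℝ, E) (Subtype.val : {y | F y = 0} → E) x) =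
      {v : E | fderiv ℝ F x v = 0} := by
  let _ := hF.chartedSpace
  have := hF.isManifold
  let D : K →L[ℝ] E := mfderiv 𝓘(ℝ, K) 𝓘(ℝ, E) (Subtype.val : {y | F y = 0} → E) x
  have hval : MDifferentiableAt 𝓘(ℝ, K) 𝓘(ℝ, E) (Subtype.val : {y | F y = 0} → E) x :=
    (hF.isSmoothEmbedding_val.contMDiff x).mdifferentiableAt (by simp)
  have hD : Function.Injective D := injective_mfderiv_of_isImmersionAtOfComplement (by simp)
    (hF.isImmersionAtOfComplement_val x)
  have hFD : (fderiv ℝ F x).comp D = 0 := by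
    have hFx := (hF.contDiff.differentiable (by simp) (x : E)).mdifferentiableAt
    have hconst : F ∘ (Subtype.val : {y | F y = 0} → E) = fun _ ↦ 0 := funext fun y ↦ y.2
    rw [← mfderiv_eq_fderiv]
    exact (mfderiv_comp x hFx hval).symm.trans (by rw [hconst, mfderiv_const]; rfl)
  have hle : LinearMap.range D.toLinearMap ≤ LinearMap.ker (fderiv ℝ F x).toLinearMap := by
    rintro _ ⟨v, rfl⟩
    exact congr($hFD v)
  have hrank := (fderiv ℝ F x).toLinearMap.finrank_range_add_finrank_ker
  rw [LinearMap.range_eq_top.2 (hF.surjective_fderiv x x.2), finrank_top,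
    ← hF.finrank_add_finrank, add_comm, Nat.add_right_cancel_iff] at hrank
  have heq := Submodule.eq_of_le_of_finrank_eq hle
    ((LinearMap.finrank_range_of_inj hD).trans hrank.symm)
  exact congrArg ((↑) : Submodule ℝ E → Set E) heq

theorem mfderiv_comp_val_eq_zero_iff {G : E → V} (x : {y | F y = 0})
    (hG : DifferentiableAt ℝ G x) :
    let _ := hF.chartedSpace
    mfderiv 𝓘(ℝ, K) 𝓘(ℝ, V) (fun y : {y | F y = 0} ↦ G y) x = 0 ↔
      ∀ v, fderiv ℝ F x v = 0 → fderiv ℝ G x v = 0 := by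
  let _ := hF.chartedSpace
  have hval : MDifferentiableAt 𝓘(ℝ, K) 𝓘(ℝ, E) (Subtype.val : {y | F y = 0} → E) x :=
    (hF.isSmoothEmbedding_val.contMDiff x).mdifferentiableAt (by simp)
  have hcomp := mfderiv_comp x hG.mdifferentiableAt hval
  rw [mfderiv_eq_fderiv] at hcomp
  have hrange := hF.range_mfderiv_val x
  constructor
  · intro h v hv
    obtain ⟨u, hu⟩ := hrange.ge hv
    rw [← hu]
    exact (congr($hcomp u)).symm.trans congr($h u)
  · intro h
    ext u
    exact (congr($hcomp u)).trans (h _ (hrange.le (mem_range_self u)))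

end IsRegularZero

end RegularLevelSet

section Profile

open Real

/-- The lower boundary curve `x₁ = sin² x₂ / (2 (x₂² + 1))` of the planar region where the product
in `definingFun` is nonnegative. -/
def lower (t : ℝ) : ℝ := sin t ^ 2 / (2 * (t ^ 2 + 1))

/-- The upper boundary curve `x₁ = 1 / (x₂² + 1)` of the planar region where the product in
`definingFun` is nonnegative. -/
def upper (t : ℝ) : ℝ := 1 / (t ^ 2 + 1)

theorem lower_nonneg (t : ℝ) : 0 ≤ lower t := by unfold lower; positivity

theorem upper_pos (t : ℝ) : 0 < upper t := by unfold upper; positivity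

theorem upper_le_upper_iff {s t : ℝ} : upper t ≤ upper s ↔ |s| ≤ |t| := by
  rw [upper, upper, one_div_le_one_div (by positivity) (by positivity), add_le_add_iff_right,
    sq_le_sq]

theorem upper_zero : upper 0 = 1 := by simp [upper]

theorem upper_le_one (t : ℝ) : upper t ≤ 1 :=
  upper_zero ▸ upper_le_upper_iff.2 (by simp)

theorem exists_upper_eq {s : ℝ} (hs : 0 < s) (hs1 : s ≤ 1) : ∃ t, 0 ≤ t ∧ upper t = s := by
  have h1 : 0 ≤ 1 / s - 1 := sub_nonneg.2 ((one_le_div hs).2 hs1)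
  exact ⟨√(1 / s - 1), sqrt_nonneg _, by rw [upper, sq_sqrt h1, sub_add_cancel, one_div_one_div]⟩

theorem two_mul_lower_le_upper (t : ℝ) : 2 * lower t ≤ upper t := by
  have h : 2 * lower t = sin t ^ 2 / (t ^ 2 + 1) := by unfold lower; field_simp
  rw [h]
  exact div_le_div_of_nonneg_right (sin_sq_le_one t) (by positivity)

theorem lower_lt_upper (t : ℝ) : lower t < upper t := by
  linarith [two_mul_lower_le_upper t, upper_pos t]

theorem lower_lt_one (t : ℝ) : lower t < 1 :=
  (lower_lt_upper t).trans_le (upper_le_one t)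

theorem lower_neg (t : ℝ) : lower (-t) = lower t := by simp [lower]

theorem upper_neg (t : ℝ) : upper (-t) = upper t := by simp [upper]

theorem lower_int_mul_pi (n : ℤ) : lower (n * π) = 0 := by simp [lower, sin_int_mul_pi]

theorem lower_nat_mul_pi (n : ℕ) : lower (n * π) = 0 := lower_int_mul_pi n

@[fun_prop]
theorem continuous_lower : Continuous lower := by
  unfold lower
  exact Continuous.div (by fun_prop) (by fun_prop) fun t ↦ by positivity

@[fun_prop]
theorem continuous_upper : Continuous upper := by
  unfold upper
  exact Continuous.div (by fun_prop) (by fun_prop) fun t ↦ by positivity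

theorem hasDerivAt_lower (t : ℝ) : HasDerivAt lower
    (sin t * (cos t * (t ^ 2 + 1) - t * sin t) / (t ^ 2 + 1) ^ 2) t := by
  have h := ((hasDerivAt_sin t).pow 2).div
    ((((hasDerivAt_id t).pow 2).add_const (1 : ℝ)).const_mul 2)
    (by simp only [id, Pi.pow_apply]; positivity)
  refine h.congr_deriv ?_
  simp only [id, Pi.pow_apply]
  field_simp
  ring

theorem hasDerivAt_upper (t : ℝ) : HasDerivAt upper (-(2 * t) / (t ^ 2 + 1) ^ 2) t := by
  have h := (hasDerivAt_const t (1 : ℝ)).div (((hasDerivAt_id t).pow 2).add_const (1 : ℝ))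
    (by simp only [id, Pi.pow_apply]; positivity)
  refine h.congr_deriv ?_
  simp only [id, Pi.pow_apply]
  field_simp
  ring

theorem cos_eq_of_deriv_lower_eq_zero {t : ℝ} (h : deriv lower t = 0) (hs : sin t ≠ 0) :
    cos t = t / (t ^ 2 + 1) * sin t := by
  have hpos : 0 < t ^ 2 + 1 := by positivity
  rw [(hasDerivAt_lower t).deriv, div_eq_zero_iff, or_iff_left (by positivity),
    mul_eq_zero, or_iff_right hs] at h
  field_simp
  linarith

theorem sin_mul_sin_le (s t : ℝ) : sin s * sin t ≤ (1 + cos (t - s)) / 2 := by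
  have h := neg_one_le_cos (s + t)
  rw [cos_add] at h
  rw [cos_sub]
  linarith

theorem half_one_add_cos_mul_lt_sin {d : ℝ} (h0 : 0 < d) (hπ : d < π) :
    (1 + cos d) / 2 * (d / 8) < sin d := by
  have hc : 0 < cos (d / 2) := cos_pos_of_mem_Ioo ⟨by linarith, by linarith⟩
  have htan : d / 2 * cos (d / 2) < sin (d / 2) := by
    rw [← lt_div_iff₀ hc, ← tan_eq_sin_div_cos]
    exact lt_tan (by linarith) (by linarith)
  have hsd : sin d = 2 * sin (d / 2) * cos (d / 2) := by
    rw [← sin_two_mul, mul_div_cancel₀ d two_ne_zero]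
  have hcd : cos d = 2 * cos (d / 2) ^ 2 - 1 := by
    rw [← cos_two_mul, mul_div_cancel₀ d two_ne_zero]
  rw [hsd, hcd]
  nlinarith [mul_pos hc (sub_pos.2 htan), mul_pos (mul_pos h0 hc) hc]

theorem mul_sub_one_div_le (s t : ℝ) : (s * t - 1) / ((s ^ 2 + 1) * (t ^ 2 + 1)) ≤ 1 / 8 := by
  rw [div_le_iff₀ (by positivity)]
  nlinarith [sq_nonneg (s * t - 3), sq_nonneg (s - t)]

theorem eq_of_deriv_lower_eq_zero {s t : ℝ} (hπ : |t - s| < π) (hst : 0 < sin s * sin t)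
    (hs : deriv lower s = 0) (ht : deriv lower t = 0) : s = t := by
  wlog hlt : s < t generalizing s t
  · by_contra hne
    exact hne (this (by rwa [abs_sub_comm]) (by rwa [mul_comm]) ht hs
      (lt_of_le_of_ne (not_lt.1 hlt) (Ne.symm hne))).symm
  exfalso
  have hd : 0 < t - s := sub_pos.2 hlt
  -- At critical points `cos t = t / (t² + 1) * sin t`, so `sin (t - s)` factors through
  -- `sin s * sin t`, and the factor is too small.
  have hsin : sin (t - s) =
      sin s * sin t * ((t - s) * ((s * t - 1) / ((s ^ 2 + 1) * (t ^ 2 + 1)))) := by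
    rw [sin_sub, cos_eq_of_deriv_lower_eq_zero hs (left_ne_zero_of_mul hst.ne'),
      cos_eq_of_deriv_lower_eq_zero ht (right_ne_zero_of_mul hst.ne')]
    field_simp
    ring
  refine (half_one_add_cos_mul_lt_sin hd ((le_abs_self _).trans_lt hπ)).not_ge ?_
  calc sin (t - s) ≤ sin s * sin t * ((t - s) * (1 / 8)) :=
        hsin.trans_le (mul_le_mul_of_nonneg_left
          (mul_le_mul_of_nonneg_left (mul_sub_one_div_le s t) hd.le) hst.le)
    _ ≤ (1 + cos (t - s)) / 2 * ((t - s) / 8) := by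
        rw [mul_one_div]
        gcongr
        exact sin_mul_sin_le s t

theorem sin_mul_sin_pos {n : ℕ} {s t : ℝ} (hs : s ∈ Ioo (n * π) ((n + 1) * π))
    (ht : t ∈ Ioo (n * π) ((n + 1) * π)) : 0 < sin s * sin t := by
  have hpos : ∀ x ∈ Ioo (n * π) ((n + 1) * π), 0 < (-1) ^ n * sin x := fun x hx ↦ by
    rw [← sin_sub_nat_mul_pi]
    exact sin_pos_of_pos_of_lt_pi (by linarith [hx.1]) (by linarith [hx.2])
  have hsq : ((-1 : ℝ) ^ n) * (-1) ^ n = 1 := by rw [← mul_pow]; simp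
  calc 0 < (-1) ^ n * sin s * ((-1) ^ n * sin t) := mul_pos (hpos s hs) (hpos t ht)
    _ = sin s * sin t := by rw [mul_mul_mul_comm, hsq, one_mul]

theorem eq_of_mem_Ioo_of_deriv_lower_eq_zero {n : ℕ} {s t : ℝ}
    (hs : s ∈ Ioo (n * π) ((n + 1) * π)) (ht : t ∈ Ioo (n * π) ((n + 1) * π))
    (hs' : deriv lower s = 0) (ht' : deriv lower t = 0) : s = t :=
  eq_of_deriv_lower_eq_zero
    (abs_lt.2 ⟨by linarith [hs.1, hs.2, ht.1, ht.2], by linarith [hs.1, hs.2, ht.1, ht.2]⟩)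
    (sin_mul_sin_pos hs ht) hs' ht'

theorem exists_isMaxOn_lower (n : ℕ) :
    ∃ p ∈ Ioo (n * π) ((n + 1) * π), IsMaxOn lower (Icc (n * π) ((n + 1) * π)) p := by
  have hπ := pi_pos
  obtain ⟨p, hp, hmax⟩ := isCompact_Icc.exists_isMaxOn
    (nonempty_Icc.2 (show n * π ≤ (n + 1) * π by nlinarith)) continuous_lower.continuousOn
  have hpos : 0 < lower p := by
    have hsin : sin (n * π + π / 2) ^ 2 = 1 := by
      rw [sin_add_pi_div_two, cos_sq', sin_nat_mul_pi]; simp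
    calc 0 < lower (n * π + π / 2) := by rw [lower, hsin]; positivity
      _ ≤ lower p := hmax ⟨by linarith, by linarith⟩
  have hne (k : ℕ) : p ≠ k * π := by
    rintro rfl
    exact hpos.ne' (lower_nat_mul_pi k)
  exact ⟨p, ⟨hp.1.lt_of_ne' (hne n), hp.2.lt_of_ne (mod_cast hne (n + 1))⟩, hmax⟩

/-- The maximum point of `lower` in `[nπ, (n+1)π]`, which is its only critical point in the
interior of that interval. -/
def peak (n : ℕ) : ℝ := (exists_isMaxOn_lower n).choose

theorem peak_mem (n : ℕ) : peak n ∈ Ioo (n * π) ((n + 1) * π) :=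
  (exists_isMaxOn_lower n).choose_spec.1

theorem isMaxOn_lower_peak (n : ℕ) : IsMaxOn lower (Icc (n * π) ((n + 1) * π)) (peak n) :=
  (exists_isMaxOn_lower n).choose_spec.2

theorem deriv_lower_peak (n : ℕ) : deriv lower (peak n) = 0 :=
  ((isMaxOn_lower_peak n).isLocalMax (Icc_mem_nhds (peak_mem n).1 (peak_mem n).2)).deriv_eq_zero

theorem sin_peak_sq_pos (n : ℕ) : 0 < sin (peak n) ^ 2 :=
  sq (sin (peak n)) ▸ sin_mul_sin_pos (peak_mem n) (peak_mem n)

theorem lower_peak_pos (n : ℕ) : 0 < lower (peak n) :=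
  div_pos (sin_peak_sq_pos n) (by positivity)

theorem lower_peak_succ_lt (n : ℕ) : lower (peak (n + 1)) < lower (peak n) := by
  have hp := peak_mem (n + 1)
  push_cast at hp
  have hn : (0 : ℝ) ≤ n * π := by positivity
  calc lower (peak (n + 1)) < lower (peak (n + 1) - π) := by
        rw [lower, lower, sin_sub_pi, neg_sq]
        refine div_lt_div_of_pos_left (sin_peak_sq_pos _) (by positivity) ?_
        nlinarith [hp.1, pi_pos]
    _ ≤ lower (peak n) := isMaxOn_lower_peak n ⟨by linarith [hp.1], by linarith [hp.2]⟩

theorem forall_lower_le_left_or_right {n : ℕ} {s t : ℝ} (ht : t ∈ Icc (n * π) ((n + 1) * π))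
    (hts : lower t ≤ s) :
    (∀ x ∈ Icc (n * π) t, lower x ≤ s) ∨ ∀ x ∈ Icc t ((n + 1) * π), lower x ≤ s := by
  -- Otherwise `lower` has an interior minimum between two higher values, a critical point
  -- other than the peak.
  by_contra! ⟨⟨x, hx, hxs⟩, y, hy, hys⟩
  obtain ⟨z, hz, hmin⟩ := isCompact_Icc.exists_isMinOn
    (nonempty_Icc.2 (hx.2.trans hy.1)) continuous_lower.continuousOn
  have hzs : lower z ≤ s := (hmin (show t ∈ Icc x y from ⟨hx.2, hy.1⟩)).trans hts
  have hz' : z ∈ Ioo x y := by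
    refine ⟨lt_of_le_of_ne hz.1 ?_, lt_of_le_of_ne hz.2 ?_⟩ <;> rintro rfl <;> linarith
  have hd : deriv lower z = 0 := (hmin.isLocalMin (Icc_mem_nhds hz'.1 hz'.2)).deriv_eq_zero
  have heq : z = peak n := eq_of_mem_Ioo_of_deriv_lower_eq_zero
    ⟨hx.1.trans_lt hz'.1, hz'.2.trans_le hy.2⟩ (peak_mem n) hd (deriv_lower_peak n)
  exact (hxs.trans_le (isMaxOn_lower_peak n ⟨hx.1, hx.2.trans ht.2⟩)).not_ge (heq ▸ hzs)

theorem exists_nat_mul_pi_mem_Ico {t : ℝ} (ht : 0 ≤ t) :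
    ∃ n : ℕ, t ∈ Ico (n * π) ((n + 1) * π) :=
  ⟨⌊t / π⌋₊, (le_div_iff₀ pi_pos).1 (Nat.floor_le (by positivity)),
    (div_lt_iff₀ pi_pos).1 (Nat.lt_floor_add_one _)⟩

theorem exists_nat_eq_or_eq_peak {t : ℝ} (ht : 0 ≤ t) (hd : deriv lower t = 0) :
    ∃ n : ℕ, t = n * π ∨ t = peak n := by
  obtain ⟨n, hn⟩ := exists_nat_mul_pi_mem_Ico ht
  rcases hn.1.eq_or_lt with h | h
  · exact ⟨n, Or.inl h.symm⟩
  · exact ⟨n, Or.inr (eq_of_mem_Ioo_of_deriv_lower_eq_zero ⟨h, hn.2⟩ (peak_mem n) hd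
      (deriv_lower_peak n))⟩

end Profile

section Label

open Real

/-- The amount, up to the positive factor `2 * (x ^ 2 + 1)`, by which `lower x` exceeds the
level `s`. -/
def excess (s x : ℝ) : ℝ := max (sin x ^ 2 - 2 * s * (x ^ 2 + 1)) 0

/-- The primitive of `excess s`. It is constant on the intervals where `lower ≤ s` and takes
different values on different ones, so it labels the components of the slices of `region`. -/
def label (s t : ℝ) : ℝ := ∫ x in (0 : ℝ)..t, excess s x

theorem excess_nonneg (s x : ℝ) : 0 ≤ excess s x := le_max_right _ _

theorem excess_eq_zero_iff {s x : ℝ} : excess s x = 0 ↔ lower x ≤ s := by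
  rw [excess, lower, max_eq_right_iff, div_le_iff₀ (by positivity), sub_nonpos]
  ring_nf

@[fun_prop]
theorem continuous_excess (s : ℝ) : Continuous (excess s) := by
  unfold excess
  fun_prop

theorem intervalIntegrable_excess (s a b : ℝ) :
    IntervalIntegrable (excess s) MeasureTheory.volume a b :=
  (continuous_excess s).intervalIntegrable a b

theorem continuous_label : Continuous fun p : ℝ × ℝ ↦ label p.1 p.2 := by
  have h : Continuous (Function.uncurry fun (p : ℝ × ℝ) x ↦ excess p.1 x) := by
    unfold Function.uncurry excess
    fun_prop
  exact intervalIntegral.continuous_parametric_intervalIntegral_of_continuous h continuous_snd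

theorem label_sub (s a b : ℝ) : label s b - label s a = ∫ x in a..b, excess s x :=
  intervalIntegral.integral_interval_sub_left (intervalIntegrable_excess s 0 b)
    (intervalIntegrable_excess s 0 a)

theorem label_zero (s : ℝ) : label s 0 = 0 := intervalIntegral.integral_same

theorem label_mono (s : ℝ) : Monotone (label s) := by
  intro a b h
  rw [← sub_nonneg, label_sub]
  exact intervalIntegral.integral_nonneg h fun x _ ↦ excess_nonneg s x

theorem label_eq_of_forall_lower_le {s a b : ℝ} (h : ∀ x ∈ uIcc a b, lower x ≤ s) :
    label s a = label s b := by
  rw [eq_comm, ← sub_eq_zero, label_sub]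
  exact (intervalIntegral.integral_congr (g := fun _ ↦ (0 : ℝ))
    fun x hx ↦ excess_eq_zero_iff.2 (h x hx)).trans intervalIntegral.integral_zero

theorem label_eq_iff {s a b : ℝ} (hab : a < b) :
    label s a = label s b ↔ ∀ x ∈ Icc a b, lower x ≤ s := by
  refine ⟨fun h x hx ↦ ?_,
    fun h ↦ label_eq_of_forall_lower_le (by rwa [uIcc_of_le hab.le])⟩
  rw [eq_comm, ← sub_eq_zero, label_sub] at h
  by_contra hlt
  rw [← excess_eq_zero_iff] at hlt
  exact (intervalIntegral.integral_pos hab (continuous_excess s).continuousOn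
    (fun y _ ↦ excess_nonneg s y) ⟨x, hx, (excess_nonneg s x).lt_of_ne' hlt⟩).ne' h

theorem label_neg (s t : ℝ) : label s (-t) = -label s t := by
  have h := intervalIntegral.integral_comp_neg (a := 0) (b := t) (excess s)
  have heven : ∀ x, excess s (-x) = excess s x := fun x ↦ by simp [excess]
  simp only [heven, neg_zero] at h
  rw [label, label, h, intervalIntegral.integral_symm]

theorem abs_label (s t : ℝ) : |label s t| = label s |t| := by
  have hnonneg : ∀ t, 0 ≤ t → 0 ≤ label s t := fun t ht ↦ label_zero s ▸ label_mono s ht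
  rcases abs_cases t with ⟨h, ht⟩ | ⟨h, ht⟩
  · rw [h, abs_of_nonneg (hnonneg t ht)]
  · rw [h, ← abs_neg, ← label_neg, abs_of_nonneg (hnonneg (-t) (by linarith))]

theorem label_antitone {s s' t : ℝ} (h : s ≤ s') (ht : 0 ≤ t) : label s' t ≤ label s t :=
  intervalIntegral.integral_mono ht (intervalIntegrable_excess _ _ _)
    (intervalIntegrable_excess _ _ _) fun x ↦ max_le_max_right 0 (by gcongr)

theorem integral_sin_sq_sub_le_label (s : ℝ) {t : ℝ} (ht : 0 ≤ t) :
    ∫ x in (0 : ℝ)..t, (sin x ^ 2 - 2 * s * (x ^ 2 + 1)) ≤ label s t :=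
  intervalIntegral.integral_mono ht (Continuous.intervalIntegrable (by fun_prop) _ _)
    (intervalIntegrable_excess _ _ _) fun _ ↦ le_max_left _ _

theorem integral_sin_sq_sub (s t : ℝ) :
    ∫ x in (0 : ℝ)..t, (sin x ^ 2 - 2 * s * (x ^ 2 + 1)) =
      (t - sin t * cos t) / 2 - 2 * s * (t ^ 3 / 3 + t) := by
  rw [intervalIntegral.integral_sub (Continuous.intervalIntegrable (by fun_prop) _ _)
    (Continuous.intervalIntegrable (by fun_prop) _ _), intervalIntegral.integral_const_mul,
    intervalIntegral.integral_add (Continuous.intervalIntegrable (by fun_prop) _ _)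
    (Continuous.intervalIntegrable (by fun_prop) _ _), integral_pow, integral_sin_sq]
  simp only [intervalIntegral.integral_const, sin_zero, cos_zero, smul_eq_mul]
  norm_num
  ring

theorem le_label {s t : ℝ} (ht : 0 ≤ t) (hs : s ≤ upper t) : t / 12 - 1 ≤ label s t := by
  have hsin : sin (t / 2) * cos (t / 2) ≤ 1 / 2 := by
    linarith [two_mul_le_add_sq (sin (t / 2)) (cos (t / 2)), sin_sq_add_cos_sq (t / 2)]
  have hupper : 2 * upper t * ((t / 2) ^ 3 / 3 + t / 2) ≤ t / 12 + 1 / 2 := by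
    rw [upper, mul_one_div, div_mul_eq_mul_div, div_le_iff₀ (by positivity)]
    nlinarith [sq_nonneg (t - 1), mul_nonneg ht (sq_nonneg t)]
  -- Up to `t / 2` the subtracted term has mean about `1 / 6`, and `sin ^ 2` has mean `1 / 2`.
  calc t / 12 - 1
      ≤ (t / 2 - sin (t / 2) * cos (t / 2)) / 2
          - 2 * upper t * ((t / 2) ^ 3 / 3 + t / 2) := by linarith
    _ ≤ label (upper t) (t / 2) :=
        integral_sin_sq_sub (upper t) (t / 2) ▸ integral_sin_sq_sub_le_label _ (by linarith)
    _ ≤ label (upper t) t := label_mono _ (by linarith)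
    _ ≤ label s t := label_antitone hs ht

end Label

section Region

open Real

/-- The planar region between the curves `lower` and `upper`, in coordinates `(x₁, x₂)`. It is the
projection of `zeroSet m` to the first two coordinates. -/
def region : Set (ℝ × ℝ) := {p | lower p.2 ≤ p.1 ∧ p.1 ≤ upper p.2}

/-- The value of `∑ yⱼ²` at the points of `zeroSet m` with first coordinates `(s, t)`. -/
def radiusSq (s t : ℝ) : ℝ := (s - lower t) * (upper t - s)

/-- The part of the slice `x₁ = s` of `region` on which `label s` takes the value `y`. -/
def fiber (s y : ℝ) : Set ℝ := {t | (s, t) ∈ region ∧ label s t = y}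

theorem fst_mem_Icc_of_mem_region {p : ℝ × ℝ} (hp : p ∈ region) : p.1 ∈ Icc (0 : ℝ) 1 :=
  ⟨(lower_nonneg _).trans hp.1, hp.2.trans (upper_le_one _)⟩

@[fun_prop]
theorem continuous_radiusSq : Continuous fun p : ℝ × ℝ ↦ radiusSq p.1 p.2 := by
  unfold radiusSq
  fun_prop

theorem radiusSq_nonneg_iff {s t : ℝ} : 0 ≤ radiusSq s t ↔ (s, t) ∈ region := by
  rw [radiusSq, mul_nonneg_iff, sub_nonneg, sub_nonneg, sub_nonpos, sub_nonpos]
  exact or_iff_left fun h ↦ (lower_lt_upper t).not_ge (h.2.trans h.1)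

theorem isClosed_region : IsClosed region := by
  have h : region = {p | 0 ≤ radiusSq p.1 p.2} := ext fun _ ↦ radiusSq_nonneg_iff.symm
  rw [h]
  exact isClosed_le continuous_const continuous_radiusSq

theorem abs_le_of_abs_label_le {s t C : ℝ} (h : (s, t) ∈ region) (hC : |label s t| ≤ C) :
    |t| ≤ 12 * (C + 1) := by
  rw [abs_label] at hC
  linarith [le_label (abs_nonneg t) (h.2.trans (upper_le_upper_iff.2 (abs_abs t).le))]

theorem isCompact_fiber (s y : ℝ) : IsCompact (fiber s y) := by
  refine Metric.isCompact_of_isClosed_isBounded ?_ ?_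
  · exact (isClosed_region.preimage (by fun_prop : Continuous fun t : ℝ ↦ (s, t))).inter
      (isClosed_eq (continuous_label.comp (by fun_prop : Continuous fun t : ℝ ↦ (s, t)))
        continuous_const)
  · rw [Metric.isBounded_iff_subset_closedBall 0]
    refine ⟨12 * (|y| + 1), fun t ht ↦ ?_⟩
    rw [mem_closedBall_zero_iff, Real.norm_eq_abs]
    exact abs_le_of_abs_label_le ht.1 (by rw [ht.2])

theorem ordConnected_fiber (s y : ℝ) : (fiber s y).OrdConnected := by
  refine ordConnected_of_Ioo fun a ha b hb hab x hx ↦ ?_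
  have hlower := (label_eq_iff hab).1 (ha.2.trans hb.2.symm)
  refine ⟨⟨hlower x (Ioo_subset_Icc_self hx), ?_⟩, ?_⟩
  · rcases le_max_iff.1 (abs_le_max_abs_abs hx.1.le hx.2.le) with h | h
    · exact ha.1.2.trans (upper_le_upper_iff.2 h)
    · exact hb.1.2.trans (upper_le_upper_iff.2 h)
  · rw [← ha.2]
    refine (label_eq_of_forall_lower_le fun z hz ↦ hlower z ?_).symm
    rw [uIcc_of_le hx.1.le] at hz
    exact ⟨hz.1, hz.2.trans hx.2.le⟩

theorem mem_fiber_of_forall_mem_region {s y t u : ℝ} (ht : t ∈ fiber s y)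
    (h : ∀ x ∈ uIcc t u, (s, x) ∈ region) : u ∈ fiber s y :=
  ⟨h u right_mem_uIcc,
    (label_eq_of_forall_lower_le fun x hx ↦ (h x hx).1).symm.trans ht.2⟩

theorem fiber_mem_nhds {s y t : ℝ} (ht : t ∈ fiber s y) (hpos : radiusSq s t ≠ 0) :
    fiber s y ∈ 𝓝 t := by
  have hcont : ContinuousAt (fun x ↦ radiusSq s x) t := by fun_prop
  have hev := hcont.eventually (lt_mem_nhds ((radiusSq_nonneg_iff.2 ht.1).lt_of_ne' hpos))
  filter_upwards [(tendsto_const_nhds.uIcc Filter.tendsto_id).eventually hev.smallSets] with u hu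
  exact mem_fiber_of_forall_mem_region ht fun x hx ↦ radiusSq_nonneg_iff.1 (hu x hx).le

theorem exists_fiber_eq_Icc {s y : ℝ} (h : (fiber s y).Nonempty) :
    ∃ a b, a ≤ b ∧ fiber s y = Icc a b ∧ radiusSq s a = 0 ∧ radiusSq s b = 0 := by
  have hconn : IsConnected (fiber s y) := ⟨h, (ordConnected_fiber s y).isPreconnected⟩
  obtain ⟨a, b, hab⟩ : ∃ a b, fiber s y = Icc a b :=
    ⟨_, _, eq_Icc_of_connected_compact hconn (isCompact_fiber s y)⟩
  have hle : a ≤ b := nonempty_Icc.1 (hab ▸ h)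
  have hzero : ∀ t ∈ Icc a b, t ∉ Ioo a b → radiusSq s t = 0 := fun t ht ht' ↦ by
    by_contra hne
    have hmem := fiber_mem_nhds (hab ▸ ht) hne
    rw [hab, Icc_mem_nhds_iff] at hmem
    exact ht' hmem
  exact ⟨a, b, hle, hab, hzero a (left_mem_Icc.2 hle) (by simp),
    hzero b (right_mem_Icc.2 hle) (by simp)⟩

end Region

section Tree

open Real

/-- The value of `label s` on the component of the slice `{t | lower t ≤ s}` containing `l * π`. -/
def branch (l : ℤ) (s : ℝ) : ℝ := label s (l * π)

/-- The level at which the branch `n` merges with the branch `n - 1`; it is the end of the branch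
`0` for `n = 0`. -/
def stemTop : ℕ → ℝ
  | 0 => 1
  | n + 1 => lower (peak n)

/-- The level `s` is below the level at which the branch `l` merges with the next one towards the
branch `0`. -/
def OnStem (l : ℤ) (s : ℝ) : Prop := l = 0 ∨ s < stemTop l.natAbs

/-- The model of the Reeb graph: the union of the graphs over `[0, 1]` of all branches. -/
def tree : Set (ℝ × ℝ) := {p | p.1 ∈ Icc (0 : ℝ) 1 ∧ ∃ l : ℤ, p.2 = branch l p.1}

theorem continuous_branch (l : ℤ) : Continuous (branch l) :=
  continuous_label.comp (by fun_prop : Continuous fun s : ℝ ↦ (s, (l : ℝ) * π))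

theorem branch_zero (s : ℝ) : branch 0 s = 0 := by simp [branch, label_zero]

theorem branch_neg (l : ℤ) (s : ℝ) : branch (-l) s = -branch l s := by
  rw [branch, branch, Int.cast_neg, neg_mul, label_neg]

theorem branch_mono {l l' : ℤ} (h : l ≤ l') (s : ℝ) : branch l s ≤ branch l' s :=
  label_mono s (mul_le_mul_of_nonneg_right (mod_cast h) pi_pos.le)

theorem stemTop_pos : ∀ n, 0 < stemTop n
  | 0 => one_pos
  | n + 1 => lower_peak_pos n

theorem stemTop_succ_lt : ∀ n, stemTop (n + 1) < stemTop n
  | 0 => lower_lt_one _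
  | n + 1 => lower_peak_succ_lt n

theorem stemTop_le_one (n : ℕ) : stemTop n ≤ 1 :=
  (strictAnti_nat_of_succ_lt stemTop_succ_lt).antitone (Nat.zero_le n)

theorem branch_succ_eq_iff (n : ℕ) (s : ℝ) :
    branch n s = branch (n + 1) s ↔ stemTop (n + 1) ≤ s := by
  have hlt : (n : ℝ) * π < (n + 1) * π := by linarith [pi_pos]
  rw [branch, branch, stemTop]
  push_cast
  rw [label_eq_iff hlt]
  exact ⟨fun h ↦ h _ (Ioo_subset_Icc_self (peak_mem n)),
    fun h x hx ↦ (isMaxOn_lower_peak n hx).trans h⟩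

theorem onStem_neg {l : ℤ} {s : ℝ} : OnStem (-l) s ↔ OnStem l s := by simp [OnStem]

theorem branch_lt_branch {l l' : ℤ} {s : ℝ} (h : l < l') (hl : OnStem l s)
    (hl' : OnStem l' s) : branch l s < branch l' s := by
  wlog hpos : 0 < l' generalizing l l'
  · have := this (neg_lt_neg h) (onStem_neg.2 hl') (onStem_neg.2 hl) (by omega)
    rwa [branch_neg, branch_neg, neg_lt_neg_iff] at this
  obtain ⟨n, rfl⟩ : ∃ n : ℕ, l' = n + 1 := ⟨(l' - 1).toNat, by omega⟩
  have hs : s < stemTop (n + 1) := hl'.resolve_left (by omega)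
  calc branch l s ≤ branch n s := branch_mono (by omega) s
    _ < branch (n + 1) s := (branch_mono (by omega) s).lt_of_ne
        fun heq ↦ ((branch_succ_eq_iff n s).1 heq).not_gt hs

theorem eq_of_branch_eq {l l' : ℤ} {s : ℝ} (hl : OnStem l s) (hl' : OnStem l' s)
    (h : branch l s = branch l' s) : l = l' := by
  by_contra hne
  rcases lt_or_gt_of_ne hne with hlt | hlt
  · exact (branch_lt_branch hlt hl hl').ne h
  · exact (branch_lt_branch hlt hl' hl).ne' h

theorem exists_onStem_nat (n : ℕ) (s : ℝ) : ∃ k : ℕ, OnStem k s ∧ branch n s = branch k s := by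
  induction n with
  | zero => exact ⟨0, Or.inl rfl, rfl⟩
  | succ n ih =>
    rcases le_or_gt (stemTop (n + 1)) s with h | h
    · obtain ⟨k, hk, hk'⟩ := ih
      exact ⟨k, hk, hk' ▸ mod_cast ((branch_succ_eq_iff n s).2 h).symm⟩
    · exact ⟨n + 1, Or.inr h, rfl⟩

theorem exists_onStem (l : ℤ) (s : ℝ) : ∃ k : ℤ, OnStem k s ∧ branch l s = branch k s := by
  obtain ⟨n, rfl | rfl⟩ := l.eq_nat_or_neg
  · obtain ⟨k, hk⟩ := exists_onStem_nat n s
    exact ⟨k, hk⟩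
  · obtain ⟨k, hk, hk'⟩ := exists_onStem_nat n s
    exact ⟨-k, onStem_neg.2 hk, by rw [branch_neg, branch_neg, hk']⟩

theorem abs_branch (l : ℤ) (s : ℝ) : |branch l s| = branch l.natAbs s := by
  rw [branch, branch, abs_label, abs_mul, abs_of_pos pi_pos, Int.natCast_natAbs, Int.cast_abs]

theorem le_abs_branch {l : ℤ} {s : ℝ} (hs : s ≤ stemTop l.natAbs) :
    ((l.natAbs : ℝ) - 1) * π / 12 - 1 ≤ |branch l s| := by
  rw [abs_branch]
  rcases hl : l.natAbs with _ | n
  · rw [Nat.cast_zero, Nat.cast_zero, branch_zero]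
    linarith [pi_pos]
  have hn : (0 : ℝ) ≤ n * π := by positivity
  have hp : n * π ≤ peak n := (peak_mem n).1.le
  have hs' : s ≤ upper (n * π) := calc
    s ≤ lower (peak n) := by rwa [hl] at hs
    _ ≤ upper (peak n) := (lower_lt_upper _).le
    _ ≤ upper (n * π) := upper_le_upper_iff.2 (abs_le_abs_of_nonneg hn hp)
  calc ((n + 1 : ℕ) - 1) * π / 12 - 1 = n * π / 12 - 1 := by push_cast; ring
    _ ≤ branch n s := le_label hn hs'
    _ ≤ branch (n + 1 : ℕ) s := branch_mono (by omega) s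

theorem exists_label_eq_branch {s t : ℝ} (h : lower t ≤ s) : ∃ l : ℤ, label s t = branch l s := by
  wlog ht : 0 ≤ t generalizing t
  · obtain ⟨l, hl⟩ := this (t := -t) (by rwa [lower_neg]) (by linarith)
    exact ⟨-l, by rw [branch_neg, ← hl, label_neg, neg_neg]⟩
  obtain ⟨n, hn⟩ := exists_nat_mul_pi_mem_Ico ht
  rcases forall_lower_le_left_or_right (Ico_subset_Icc_self hn) h with hleft | hright
  · exact ⟨n, (label_eq_of_forall_lower_le (by rwa [Int.cast_natCast, uIcc_of_le hn.1])).symm⟩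
  · refine ⟨n + 1, label_eq_of_forall_lower_le ?_⟩
    push_cast
    rwa [uIcc_of_le hn.2.le]

theorem exists_mem_region_label_eq_branch {s : ℝ} (hs : s ∈ Icc (0 : ℝ) 1) (l : ℤ) :
    ∃ t, (s, t) ∈ region ∧ label s t = branch l s := by
  wlog hl : 0 ≤ l generalizing l
  · obtain ⟨t, ht, ht'⟩ := this (-l) (by omega)
    refine ⟨-t, ?_, by rw [label_neg, ht', branch_neg, neg_neg]⟩
    simpa only [region, mem_ofPred_eq, lower_neg, upper_neg] using ht
  rcases le_or_gt s (upper (l * π)) with hle | hlt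
  · exact ⟨l * π, ⟨by simpa only [lower_int_mul_pi] using hs.1, hle⟩, rfl⟩
  obtain ⟨T, hT0, rfl⟩ := exists_upper_eq ((upper_pos _).trans hlt) hs.2
  refine ⟨T, ⟨(lower_lt_upper T).le, le_rfl⟩, label_eq_of_forall_lower_le fun x hx ↦ ?_⟩
  have hTl : T ≤ l * π := by
    have hnonneg : 0 ≤ l * π := mul_nonneg (mod_cast hl) pi_pos.le
    have := not_le.1 (mt upper_le_upper_iff.2 hlt.not_ge)
    rw [abs_of_nonneg hT0, abs_of_nonneg hnonneg] at this
    exact this.le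
  rw [uIcc_of_le hTl] at hx
  exact (lower_lt_upper x).le.trans (upper_le_upper_iff.2 (abs_le_abs_of_nonneg hT0 hx.1))

theorem image_region : (fun p : ℝ × ℝ ↦ (p.1, label p.1 p.2)) '' region = tree := by
  ext ⟨s, y⟩
  constructor
  · rintro ⟨p, hp, h⟩
    obtain ⟨rfl, rfl⟩ := Prod.mk.inj h
    exact ⟨fst_mem_Icc_of_mem_region (p := p) hp, exists_label_eq_branch hp.1⟩
  · rintro ⟨hs, l, hl⟩
    obtain ⟨t, ht, ht'⟩ := exists_mem_region_label_eq_branch hs l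
    exact ⟨(s, t), ht, Prod.ext rfl (ht'.trans hl.symm)⟩

end Tree

section ArcDecomposition

universe u

/-- A decomposition of a space into vertices and locally finitely many arcs joining them, each of
them parametrized by `[-1, 1]`. This is the data of a graph structure without loops. -/
structure ArcDecomposition (X : Type u) [TopologicalSpace X] where
  vertices : Set X
  ι : Type u
  arc : ι → ℝ → X
  continuousOn_arc : ∀ i, ContinuousOn (arc i) (Icc (-1) 1)
  injOn_arc : ∀ i, InjOn (arc i) (Icc (-1) 1)
  left_mem : ∀ i, arc i (-1) ∈ vertices
  right_mem : ∀ i, arc i 1 ∈ vertices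
  arc_notMem : ∀ i, ∀ t ∈ Ioo (-1 : ℝ) 1, arc i t ∉ vertices
  eq_of_arc_eq : ∀ i j, ∀ t ∈ Ioo (-1 : ℝ) 1, ∀ t' ∈ Ioo (-1 : ℝ) 1, arc i t = arc j t' → i = j
  cover : ∀ x, x ∈ vertices ∨ ∃ i, ∃ t ∈ Icc (-1 : ℝ) 1, arc i t = x
  locallyFinite_vertex : LocallyFinite fun v : vertices ↦ ({(v : X)} : Set X)
  locallyFinite_arc : LocallyFinite fun i ↦ arc i '' Icc (-1) 1

theorem ball_fin_one :
    Metric.ball (0 : Fin 1 → ℝ) 1 = (fun f ↦ f 0) ⁻¹' Ioo (-1) 1 := by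
  ext f
  rw [mem_ball_zero_iff, pi_norm_lt_iff one_pos]
  simp [abs_lt]

theorem closedBall_fin_one :
    Metric.closedBall (0 : Fin 1 → ℝ) 1 = (fun f ↦ f 0) ⁻¹' Icc (-1) 1 := by
  ext f
  rw [mem_closedBall_zero_iff, pi_norm_le_iff_of_nonneg zero_le_one]
  simp [abs_le]

theorem apply_zero_eq_of_mem_sphere {f : Fin 1 → ℝ} (hf : f ∈ Metric.sphere (0 : Fin 1 → ℝ) 1) :
    f 0 = -1 ∨ f 0 = 1 := by
  rw [← Metric.closedBall_sdiff_ball, closedBall_fin_one, ball_fin_one, ← preimage_sdiff,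
    Icc_sdiff_Ioo_same (by norm_num)] at hf
  exact hf

theorem image_comp_apply_zero_preimage {X : Type*} (p : ℝ → X) (s : Set ℝ) :
    (fun f : Fin 1 → ℝ ↦ p (f 0)) '' ((fun f ↦ f 0) ⁻¹' s) = p '' s := by
  rw [← image_image p, image_preimage_eq s (Function.surjective_eval 0)]

theorem continuousOn_symm_of_isCompact {α β : Type*} [TopologicalSpace α] [TopologicalSpace β]
    [T2Space β] (e : PartialEquiv α β) {K : Set α} (hK : IsCompact K) (hsub : e.source ⊆ K)
    (hcont : ContinuousOn e K) (hinj : InjOn e K) : ContinuousOn e.symm e.target := by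
  rw [continuousOn_iff_isClosed]
  intro C hC
  refine ⟨e '' (C ∩ K),
    ((hK.inter_left hC).image_of_continuousOn (hcont.mono inter_subset_right)).isClosed, ?_⟩
  ext x
  constructor
  · rintro ⟨hxC, hx⟩
    exact ⟨⟨_, ⟨hxC, hsub (e.map_target hx)⟩, e.right_inv hx⟩, hx⟩
  · rintro ⟨⟨y, ⟨hyC, hyK⟩, rfl⟩, hx⟩
    have hy : e.symm (e y) = y := hinj (hsub (e.map_target hx)) hyK (e.right_inv hx)
    exact ⟨by rwa [mem_preimage, hy], hx⟩

namespace ArcDecomposition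

variable {X : Type u} [TopologicalSpace X] (D : ArcDecomposition X)

/-- The cells of the CW structure given by a decomposition into arcs. -/
def Cell : ℕ → Type u
  | 0 => D.vertices
  | 1 => D.ι
  | _ + 2 => PEmpty

theorem continuousOn_arc_apply_zero (i : D.ι) :
    ContinuousOn (fun f : Fin 1 → ℝ ↦ D.arc i (f 0)) (Metric.closedBall 0 1) :=
  (D.continuousOn_arc i).comp (continuous_apply 0).continuousOn closedBall_fin_one.le

theorem injOn_arc_apply_zero (i : D.ι) :
    InjOn (fun f : Fin 1 → ℝ ↦ D.arc i (f 0)) (Metric.closedBall 0 1) :=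
  (D.injOn_arc i).comp ((Equiv.funUnique (Fin 1) ℝ).injective.injOn) closedBall_fin_one.le

/-- The characteristic maps of the CW structure given by a decomposition into arcs. -/
def charMap : (n : ℕ) → D.Cell n → PartialEquiv (Fin n → ℝ) X
  | 0, v => InjOn.toPartialEquiv (fun _ ↦ v.1) (Metric.ball 0 1)
      (fun _ _ _ _ _ ↦ Subsingleton.elim _ _)
  | 1, i => InjOn.toPartialEquiv (fun f ↦ D.arc i (f 0)) (Metric.ball 0 1)
      ((D.injOn_arc_apply_zero i).mono Metric.ball_subset_closedBall)
  | _ + 2, e => e.elim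

theorem charMap_zero_image_ball (v : D.vertices) :
    D.charMap 0 v '' Metric.ball 0 1 = {(v : X)} :=
  Nonempty.image_const ⟨0, Metric.mem_ball_self one_pos⟩ _

theorem charMap_zero_image_closedBall (v : D.vertices) :
    D.charMap 0 v '' Metric.closedBall 0 1 = {(v : X)} :=
  Nonempty.image_const ⟨0, Metric.mem_closedBall_self zero_le_one⟩ _

theorem charMap_one_image_ball (i : D.ι) :
    D.charMap 1 i '' Metric.ball 0 1 = D.arc i '' Ioo (-1) 1 := by
  rw [ball_fin_one]
  exact image_comp_apply_zero_preimage _ _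

theorem charMap_one_image_closedBall (i : D.ι) :
    D.charMap 1 i '' Metric.closedBall 0 1 = D.arc i '' Icc (-1) 1 := by
  rw [closedBall_fin_one]
  exact image_comp_apply_zero_preimage _ _

theorem locallyFinite_charMap : LocallyFinite
    fun p : Σ n, D.Cell n ↦ D.charMap p.1 p.2 '' Metric.closedBall 0 1 := by
  intro x
  obtain ⟨U, hU, hUf⟩ := D.locallyFinite_vertex x
  obtain ⟨W, hW, hWf⟩ := D.locallyFinite_arc x
  refine ⟨U ∩ W, Filter.inter_mem hU hW, ((hUf.image fun v ↦ (⟨0, v⟩ : Σ n, D.Cell n)).union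
    (hWf.image fun i ↦ (⟨1, i⟩ : Σ n, D.Cell n))).subset ?_⟩
  rintro ⟨n, c⟩ ⟨y, hy, hyU, hyW⟩
  match n, c with
  | 0, v => exact Or.inl ⟨v, ⟨y, (D.charMap_zero_image_closedBall v).subset hy, hyU⟩, rfl⟩
  | 1, i => exact Or.inr ⟨i, ⟨y, (D.charMap_one_image_closedBall i).subset hy, hyW⟩, rfl⟩

theorem iUnion_charMap : ⋃ (n) (c : D.Cell n), D.charMap n c '' Metric.closedBall 0 1 = univ := by
  rw [eq_univ_iff_forall]
  intro x
  rcases D.cover x with hx | ⟨i, t, ht, rfl⟩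
  · exact mem_iUnion₂.2 ⟨0, (⟨x, hx⟩ : D.vertices),
      (D.charMap_zero_image_closedBall ⟨x, hx⟩).superset rfl⟩
  · exact mem_iUnion₂.2 ⟨1, i,
      (D.charMap_one_image_closedBall i).superset (mem_image_of_mem _ ht)⟩

theorem continuousOn_charMap : ∀ (n : ℕ) (c : D.Cell n),
    ContinuousOn (D.charMap n c) (Metric.closedBall 0 1)
  | 0, v => (continuous_const (y := (v.1 : X))).continuousOn
  | 1, i => D.continuousOn_arc_apply_zero i

theorem continuousOn_charMap_symm [T2Space X] : ∀ (n : ℕ) (c : D.Cell n),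
    ContinuousOn (D.charMap n c).symm (D.charMap n c).target
  | 0, _ => (continuous_of_const fun _ _ ↦ Subsingleton.elim _ _).continuousOn
  | 1, i => continuousOn_symm_of_isCompact (D.charMap 1 i) (isCompact_closedBall 0 1)
      Metric.ball_subset_closedBall (D.continuousOn_arc_apply_zero i) (D.injOn_arc_apply_zero i)

theorem pairwiseDisjoint_charMap : (univ : Set (Σ n, D.Cell n)).PairwiseDisjoint
    fun p ↦ D.charMap p.1 p.2 '' Metric.ball 0 1 := by
  rintro ⟨n, c⟩ - ⟨n', c'⟩ - hne
  rw [Function.onFun, disjoint_left]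
  intro x hx hx'
  match n, c, n', c' with
  | 0, v, 0, v' =>
    have h : x = v.1 := (D.charMap_zero_image_ball v).subset hx
    have h' : x = v'.1 := (D.charMap_zero_image_ball v').subset hx'
    exact hne (congrArg (Sigma.mk 0) (Subtype.ext (h.symm.trans h')))
  | 0, v, 1, i =>
    have h : x = v.1 := (D.charMap_zero_image_ball v).subset hx
    obtain ⟨t, ht, rfl⟩ := (D.charMap_one_image_ball i).subset hx'
    exact D.arc_notMem i t ht (h ▸ v.2)
  | 1, i, 0, v =>
    have h : x = v.1 := (D.charMap_zero_image_ball v).subset hx'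
    obtain ⟨t, ht, rfl⟩ := (D.charMap_one_image_ball i).subset hx
    exact D.arc_notMem i t ht (h ▸ v.2)
  | 1, i, 1, j =>
    obtain ⟨t, ht, rfl⟩ := (D.charMap_one_image_ball i).subset hx
    obtain ⟨t', ht', h⟩ := (D.charMap_one_image_ball j).subset hx'
    exact hne (congrArg (Sigma.mk 1) (D.eq_of_arc_eq i j t ht t' ht' h.symm))

theorem exists_mapsTo_charMap_sphere (n : ℕ) (c : D.Cell n) :
    ∃ I : Π m, Finset (D.Cell m), MapsTo (D.charMap n c) (Metric.sphere 0 1)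
      (⋃ (m < n) (j ∈ I m), D.charMap m j '' Metric.closedBall 0 1) := by
  match n, c with
  | 0, v =>
    refine ⟨fun _ ↦ ∅, fun f hf ↦ ?_⟩
    rw [Subsingleton.elim f 0, mem_sphere_zero_iff_norm, norm_zero] at hf
    exact absurd hf zero_ne_one
  | 1, i =>
    classical
    let I : (m : ℕ) → Finset (D.Cell m)
      | 0 => ({⟨_, D.left_mem i⟩, ⟨_, D.right_mem i⟩} : Finset D.vertices)
      | _ + 1 => ∅
    have hvertex : ∀ v : D.vertices, v ∈ I 0 →
        (v : X) ∈ ⋃ (m < 1) (j ∈ I m), D.charMap m j '' Metric.closedBall 0 1 := fun v hv ↦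
      mem_iUnion₂.2 ⟨0, one_pos, mem_iUnion₂.2
        ⟨v, hv, (D.charMap_zero_image_closedBall v).superset rfl⟩⟩
    refine ⟨I, fun f hf ↦ ?_⟩
    change D.arc i (f 0) ∈ _
    rcases apply_zero_eq_of_mem_sphere hf with h | h <;> rw [h]
    · exact hvertex ⟨_, D.left_mem i⟩ (Finset.mem_insert_self _ _)
    · exact hvertex ⟨_, D.right_mem i⟩ (Finset.mem_insert_of_mem (Finset.mem_singleton_self _))

theorem isClosed_of_isClosed_inter_charMap {A : Set X}
    (hA : ∀ n (c : D.Cell n), IsClosed (A ∩ D.charMap n c '' Metric.closedBall 0 1)) :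
    IsClosed A := by
  have hU : A = ⋃ p : Σ n, D.Cell n, A ∩ D.charMap p.1 p.2 '' Metric.closedBall 0 1 := by
    rw [← inter_iUnion, iUnion_sigma, D.iUnion_charMap, inter_univ]
  rw [hU]
  exact (D.locallyFinite_charMap.subset fun p ↦ inter_subset_right).isClosed_iUnion
    fun p ↦ hA p.1 p.2

variable {Y : Type u} [TopologicalSpace Y] (φ : X ≃ₜ Y)

theorem locallyFinite_singleton_image :
    LocallyFinite fun v : φ '' D.vertices ↦ ({(v : Y)} : Set Y) := by
  let e : φ '' D.vertices ≃ₜ D.vertices := (φ.image D.vertices).symm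
  have h := (D.locallyFinite_vertex.preimage_continuous φ.symm.continuous).comp_injective
    e.injective
  convert h using 2 with v
  have hv : φ (e v) = v := congrArg Subtype.val ((φ.image D.vertices).apply_symm_apply v)
  rw [Function.comp_apply, ← φ.image_eq_preimage_symm, image_singleton, hv]

theorem locallyFinite_image_arc : LocallyFinite fun i ↦ (fun t ↦ φ (D.arc i t)) '' Icc (-1) 1 := by
  have h := D.locallyFinite_arc.preimage_continuous φ.symm.continuous
  simpa only [← φ.image_eq_preimage_symm, image_image] using h

/-- Transport of a decomposition into arcs along a homeomorphism. -/
def map : ArcDecomposition Y where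
  vertices := φ '' D.vertices
  ι := D.ι
  arc i t := φ (D.arc i t)
  continuousOn_arc i := φ.continuous.comp_continuousOn (D.continuousOn_arc i)
  injOn_arc i _ ht _ ht' h := D.injOn_arc i ht ht' (φ.injective h)
  left_mem i := mem_image_of_mem _ (D.left_mem i)
  right_mem i := mem_image_of_mem _ (D.right_mem i)
  arc_notMem i t ht h := D.arc_notMem i t ht (φ.injective.mem_set_image.1 h)
  eq_of_arc_eq i j t ht t' ht' h := D.eq_of_arc_eq i j t ht t' ht' (φ.injective h)
  cover := φ.surjective.forall.2 fun x ↦ (D.cover x).imp (mem_image_of_mem φ)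
    fun ⟨i, t, ht, h⟩ ↦ ⟨i, t, ht, congrArg φ h⟩
  locallyFinite_vertex := D.locallyFinite_singleton_image φ
  locallyFinite_arc := D.locallyFinite_image_arc φ

variable [T2Space X]

/-- The CW structure given by a decomposition into arcs. It is not an instance, as it depends on
the decomposition. -/
@[reducible]
def cwComplex : CWComplex (univ : Set X) where
  cell := D.Cell
  map := D.charMap
  source_eq n c := match n, c with
    | 0, _ => rfl
    | 1, _ => rfl
  continuousOn := D.continuousOn_charMap
  continuousOn_symm := D.continuousOn_charMap_symm
  pairwiseDisjoint' := D.pairwiseDisjoint_charMap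
  mapsTo' := D.exists_mapsTo_charMap_sphere
  closed' _ _ := D.isClosed_of_isClosed_inter_charMap
  union' := D.iUnion_charMap

theorem openCells_zero :
    letI := D.cwComplex
    openCells X 0 = (fun v ↦ {v}) '' D.vertices :=
  (congrArg range (funext D.charMap_zero_image_ball)).trans (range_comp _ _) |>.trans
    (by rw [Subtype.range_coe])

theorem openCells_one :
    letI := D.cwComplex
    openCells X 1 = range fun i ↦ D.arc i '' Ioo (-1) 1 :=
  congrArg range (funext D.charMap_one_image_ball)

theorem openCells_add_two (n : ℕ) :
    letI := D.cwComplex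
    openCells X (n + 2) = ∅ :=
  range_eq_empty_iff.2 (inferInstanceAs (IsEmpty PEmpty))

theorem vertexSet_eq :
    letI := D.cwComplex
    vertexSet X = D.vertices := by
  let _ := D.cwComplex
  rw [vertexSet, D.openCells_zero, sUnion_image, biUnion_of_singleton]

theorem isGraph [Nonempty D.ι] :
    letI := D.cwComplex
    IsGraph X := by
  let _ := D.cwComplex
  refine ⟨inferInstance, ?_, ?_, D.locallyFinite_charMap, ?_⟩
  · rw [D.openCells_one]
    exact range_nonempty _
  · intro n hn
    obtain ⟨k, rfl⟩ := Nat.exists_eq_add_of_le' hn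
    exact inferInstanceAs (IsEmpty PEmpty)
  · rintro _ ⟨i, rfl⟩
    have h : RelCWComplex.closedCell 1 i = D.arc i '' Icc (-1) 1 :=
      D.charMap_one_image_closedBall i
    rw [RelCWComplex.closure_openCell_eq_closedCell, h]
    have hcont : Continuous (Equiv.Set.imageOfInjOn (D.arc i) _ (D.injOn_arc i)) :=
      Continuous.subtype_mk (continuousOn_iff_continuous_domRestrict.1 (D.continuousOn_arc i)) _
    exact ⟨hcont.homeoOfEquivCompactToT2.symm⟩

theorem isInfiniteGraph [Infinite D.ι] :
    letI := D.cwComplex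
    IsInfiniteGraph X := by
  let _ := D.cwComplex
  refine ⟨D.isGraph, fun h ↦ ?_⟩
  have : Finite D.ι := h.toFiniteType.finite_cell 1
  exact not_finite D.ι

theorem graphIsomorphic_map [T2Space Y] :
    letI := D.cwComplex
    letI := (D.map φ).cwComplex
    GraphIsomorphic X Y := by
  let _ := D.cwComplex
  let _ := (D.map φ).cwComplex
  refine ⟨φ, fun n ↦ ?_⟩
  match n with
  | 0 =>
    rw [D.openCells_zero, (D.map φ).openCells_zero, image_image]
    simp only [image_singleton]
    exact (image_image (fun v ↦ ({v} : Set Y)) φ D.vertices).symm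
  | 1 =>
    rw [D.openCells_one, (D.map φ).openCells_one, ← range_comp]
    exact congrArg range (funext fun i ↦ image_image _ _ _)
  | n + 2 => rw [D.openCells_add_two, (D.map φ).openCells_add_two, image_empty]

end ArcDecomposition

end ArcDecomposition

section TreeGraph

open Real

theorem exists_branch_eq_branch_of_ne_zero {l : ℤ} (hl : l ≠ 0) :
    ∃ k : ℤ, l.natAbs = k.natAbs + 1 ∧
      branch l (stemTop l.natAbs) = branch k (stemTop l.natAbs) := by
  wlog hpos : 0 < l generalizing l
  · obtain ⟨k, hk, hb⟩ := this (neg_ne_zero.2 hl) (by omega)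
    rw [Int.natAbs_neg] at hk hb
    exact ⟨-k, by rwa [Int.natAbs_neg], by rw [branch_neg k, ← hb, branch_neg, neg_neg]⟩
  obtain ⟨n, rfl⟩ : ∃ n : ℕ, l = n + 1 := ⟨(l - 1).toNat, by omega⟩
  have hn : ((n : ℤ) + 1).natAbs = n + 1 := by omega
  exact ⟨n, hn, ((branch_succ_eq_iff n _).2 (by rw [hn])).symm⟩

/-- The lower end of the edges of `tree`. The stem `l` is cut at the level at which the next branch
merges into it: `(l, false)` is the edge below this level and `(l, true)` the one above it. -/
def edgeLo (i : ℤ × Bool) : ℝ := if i.2 then stemTop (i.1.natAbs + 1) else 0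

/-- The upper end of the edges of `tree`. -/
def edgeHi (i : ℤ × Bool) : ℝ := if i.2 then stemTop i.1.natAbs else stemTop (i.1.natAbs + 1)

theorem edgeLo_nonneg (i : ℤ × Bool) : 0 ≤ edgeLo i := by
  unfold edgeLo
  split_ifs
  · exact (stemTop_pos _).le
  · exact le_rfl

theorem edgeHi_le_stemTop (i : ℤ × Bool) : edgeHi i ≤ stemTop i.1.natAbs := by
  unfold edgeHi
  split_ifs
  · exact le_rfl
  · exact (stemTop_succ_lt _).le

theorem edgeLo_lt_edgeHi (i : ℤ × Bool) : edgeLo i < edgeHi i := by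
  unfold edgeLo edgeHi
  split_ifs
  · exact stemTop_succ_lt _
  · exact stemTop_pos _

/-- The affine parametrization of the levels of an edge by `[-1, 1]`. -/
def edgeLevel (i : ℤ × Bool) (r : ℝ) : ℝ := ((1 - r) * edgeLo i + (1 + r) * edgeHi i) / 2

@[fun_prop]
theorem continuous_edgeLevel (i : ℤ × Bool) : Continuous (edgeLevel i) := by
  unfold edgeLevel
  fun_prop

theorem edgeLevel_neg_one (i : ℤ × Bool) : edgeLevel i (-1) = edgeLo i := by
  unfold edgeLevel
  ring

theorem edgeLevel_one (i : ℤ × Bool) : edgeLevel i 1 = edgeHi i := by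
  unfold edgeLevel
  ring

theorem strictMono_edgeLevel (i : ℤ × Bool) : StrictMono (edgeLevel i) := by
  intro r r' h
  unfold edgeLevel
  nlinarith [mul_pos (sub_pos.2 h) (sub_pos.2 (edgeLo_lt_edgeHi i))]

theorem edgeLevel_mem_Icc {i : ℤ × Bool} {r : ℝ} (hr : r ∈ Icc (-1 : ℝ) 1) :
    edgeLevel i r ∈ Icc (edgeLo i) (edgeHi i) := by
  rw [← edgeLevel_neg_one, ← edgeLevel_one]
  exact (strictMono_edgeLevel i).monotone.mapsTo_Icc hr

theorem edgeLevel_mem_Ioo {i : ℤ × Bool} {r : ℝ} (hr : r ∈ Ioo (-1 : ℝ) 1) :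
    edgeLevel i r ∈ Ioo (edgeLo i) (edgeHi i) := by
  rw [← edgeLevel_neg_one, ← edgeLevel_one]
  exact (strictMono_edgeLevel i).mapsTo_Ioo hr

theorem exists_edgeLevel_eq {i : ℤ × Bool} {s : ℝ} (hs : s ∈ Icc (edgeLo i) (edgeHi i)) :
    ∃ r ∈ Icc (-1 : ℝ) 1, edgeLevel i r = s := by
  rw [← edgeLevel_neg_one, ← edgeLevel_one] at hs
  exact intermediate_value_Icc (by norm_num) (continuous_edgeLevel i).continuousOn hs

theorem edgeLevel_mem_unitInterval {i : ℤ × Bool} {r : ℝ} (hr : r ∈ Icc (-1 : ℝ) 1) :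
    edgeLevel i r ∈ Icc (0 : ℝ) 1 :=
  ⟨(edgeLo_nonneg i).trans (edgeLevel_mem_Icc hr).1,
    (edgeLevel_mem_Icc hr).2.trans ((edgeHi_le_stemTop i).trans (stemTop_le_one _))⟩

/-- The arcs of `tree`, extended to be constant outside the levels in `[0, 1]`. -/
def treeArc (i : ℤ × Bool) (r : ℝ) : tree :=
  ⟨(projIcc 0 1 zero_le_one (edgeLevel i r), branch i.1 (projIcc 0 1 zero_le_one (edgeLevel i r))),
    Subtype.prop _, i.1, rfl⟩

theorem coe_treeArc {i : ℤ × Bool} {r : ℝ} (hr : r ∈ Icc (-1 : ℝ) 1) :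
    (treeArc i r : ℝ × ℝ) = (edgeLevel i r, branch i.1 (edgeLevel i r)) := by
  have h : (projIcc 0 1 zero_le_one (edgeLevel i r) : ℝ) = edgeLevel i r :=
    congrArg Subtype.val (projIcc_of_mem zero_le_one (edgeLevel_mem_unitInterval hr))
  simp only [treeArc, h]

theorem coe_treeArc_neg_one (i : ℤ × Bool) :
    (treeArc i (-1) : ℝ × ℝ) = (edgeLo i, branch i.1 (edgeLo i)) := by
  rw [coe_treeArc (by simp), edgeLevel_neg_one]

theorem coe_treeArc_one (i : ℤ × Bool) :
    (treeArc i 1 : ℝ × ℝ) = (edgeHi i, branch i.1 (edgeHi i)) := by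
  rw [coe_treeArc (by simp), edgeLevel_one]

theorem continuous_treeArc (i : ℤ × Bool) : Continuous (treeArc i) := by
  have h : Continuous fun r ↦ (projIcc 0 1 zero_le_one (edgeLevel i r) : ℝ) :=
    continuous_subtype_val.comp (continuous_projIcc.comp (continuous_edgeLevel i))
  exact (h.prodMk ((continuous_branch i.1).comp h)).subtype_mk _

theorem injOn_treeArc (i : ℤ × Bool) : InjOn (treeArc i) (Icc (-1) 1) := by
  intro r hr r' hr' h
  have hlevel := congrArg (fun q : tree ↦ q.1.1) h
  simp only [coe_treeArc hr, coe_treeArc hr'] at hlevel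
  exact (strictMono_edgeLevel i).injective hlevel

/-- The vertices of `tree`: the free ends, the merging points and the top. -/
def treeVertices : Set tree := {p | ∃ l : ℤ, OnStem l p.1.1 ∧ p.1.2 = branch l p.1.1 ∧
  (p.1.1 = 0 ∨ p.1.1 = stemTop (l.natAbs + 1) ∨ p.1.1 = 1)}

theorem mem_treeVertices_of_branch {l : ℤ} {p : tree} (h : p.1.2 = branch l p.1.1)
    (hs : p.1.1 = 0 ∨ p.1.1 = stemTop (l.natAbs + 1)) : p ∈ treeVertices := by
  refine ⟨l, Or.inr ?_, h, hs.imp_right Or.inl⟩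
  rcases hs with hs | hs
  · rw [hs]; exact stemTop_pos _
  · rw [hs]; exact stemTop_succ_lt _

theorem mem_treeVertices_of_stemTop {l : ℤ} {p : tree} (h : p.1.2 = branch l p.1.1)
    (hs : p.1.1 = stemTop l.natAbs) : p ∈ treeVertices := by
  obtain rfl | hl := eq_or_ne l 0
  · exact ⟨0, Or.inl rfl, h, Or.inr (Or.inr hs)⟩
  · obtain ⟨k, hk, hb⟩ := exists_branch_eq_branch_of_ne_zero hl
    exact mem_treeVertices_of_branch (l := k) (by rw [h, hs, hb]) (Or.inr (by rw [hs, hk]))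

theorem treeArc_neg_one_mem_treeVertices (i : ℤ × Bool) : treeArc i (-1) ∈ treeVertices := by
  refine mem_treeVertices_of_branch (l := i.1) (by rw [coe_treeArc_neg_one]) ?_
  rw [coe_treeArc_neg_one]
  unfold edgeLo
  split_ifs
  · exact Or.inr rfl
  · exact Or.inl rfl

theorem treeArc_one_mem_treeVertices (i : ℤ × Bool) : treeArc i 1 ∈ treeVertices := by
  have h : (treeArc i 1).1.2 = branch i.1 (treeArc i 1).1.1 := by rw [coe_treeArc_one]
  by_cases hi : i.2
  · exact mem_treeVertices_of_stemTop h (by rw [coe_treeArc_one, edgeHi, if_pos hi])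
  · exact mem_treeVertices_of_branch h (Or.inr (by rw [coe_treeArc_one, edgeHi, if_neg hi]))

theorem exists_eq_treeArc_of_mem_treeVertices {p : tree} (hp : p ∈ treeVertices) :
    ∃ i, p = treeArc i (-1) ∨ p = treeArc i 1 := by
  obtain ⟨l, hl, hb, h | h | h⟩ := hp
  · refine ⟨(l, false), Or.inl (Subtype.ext ?_)⟩
    rw [coe_treeArc_neg_one]
    exact Prod.ext h (by rw [hb, h]; rfl)
  · refine ⟨(l, false), Or.inr (Subtype.ext ?_)⟩
    rw [coe_treeArc_one]
    exact Prod.ext h (by rw [hb, h]; rfl)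
  · obtain rfl : l = 0 := hl.resolve_right fun hlt ↦ (hlt.trans_le (stemTop_le_one _)).ne h
    refine ⟨(0, true), Or.inr (Subtype.ext ?_)⟩
    rw [coe_treeArc_one]
    exact Prod.ext h (by rw [hb, h]; rfl)

theorem onStem_edgeLevel {i : ℤ × Bool} {r : ℝ} (hr : r ∈ Ioo (-1 : ℝ) 1) :
    OnStem i.1 (edgeLevel i r) :=
  Or.inr ((edgeLevel_mem_Ioo hr).2.trans_le (edgeHi_le_stemTop i))

theorem treeArc_notMem_treeVertices {i : ℤ × Bool} {r : ℝ} (hr : r ∈ Ioo (-1 : ℝ) 1) :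
    treeArc i r ∉ treeVertices := by
  rintro ⟨l, hl, hb, hs⟩
  simp only [coe_treeArc (Ioo_subset_Icc_self hr)] at hl hb hs
  obtain rfl := eq_of_branch_eq hl (onStem_edgeLevel hr) hb.symm
  have h := edgeLevel_mem_Ioo (i := i) hr
  rcases hs with hs | hs | hs
  · exact ((edgeLo_nonneg i).trans_lt h.1).ne' hs
  · rw [hs] at h
    unfold edgeLo edgeHi at h
    split_ifs at h
    · exact h.1.false
    · exact h.2.false
  · exact (h.2.trans_le ((edgeHi_le_stemTop i).trans (stemTop_le_one _))).ne hs

theorem eq_of_treeArc_eq {i j : ℤ × Bool} {r r' : ℝ} (hr : r ∈ Ioo (-1 : ℝ) 1)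
    (hr' : r' ∈ Ioo (-1 : ℝ) 1) (h : treeArc i r = treeArc j r') : i = j := by
  have h' := congrArg Subtype.val h
  rw [coe_treeArc (Ioo_subset_Icc_self hr), coe_treeArc (Ioo_subset_Icc_self hr')] at h'
  obtain ⟨hlevel, hbranch⟩ := Prod.mk.inj h'
  have hstem : i.1 = j.1 := by
    rw [← hlevel] at hbranch
    exact eq_of_branch_eq (onStem_edgeLevel hr) (hlevel ▸ onStem_edgeLevel hr') hbranch
  refine Prod.ext hstem ?_
  have hi := edgeLevel_mem_Ioo (i := i) hr
  have hj := edgeLevel_mem_Ioo (i := j) hr'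
  unfold edgeLo edgeHi at hi hj
  rw [← hlevel, ← hstem] at hj
  rcases hi2 : i.2 with _ | _ <;> rcases hj2 : j.2 with _ | _ <;>
    simp only [hi2, hj2, Bool.false_eq_true, if_false, if_true] at hi hj ⊢
  · exact (lt_asymm hi.2 hj.1).elim
  · exact (lt_asymm hi.1 hj.2).elim

theorem exists_treeArc_eq (p : tree) : ∃ i, ∃ r ∈ Icc (-1 : ℝ) 1, treeArc i r = p := by
  obtain ⟨hs, l', hl'⟩ := p.2
  obtain ⟨l, hl, hll⟩ := exists_onStem l' p.1.1
  have hle : p.1.1 ≤ stemTop l.natAbs := by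
    rcases hl with rfl | hl
    · exact hs.2
    · exact hl.le
  obtain ⟨b, hb⟩ : ∃ b, p.1.1 ∈ Icc (edgeLo (l, b)) (edgeHi (l, b)) := by
    rcases le_total p.1.1 (stemTop (l.natAbs + 1)) with h | h
    · exact ⟨false, by simpa [edgeLo, edgeHi] using ⟨hs.1, h⟩⟩
    · exact ⟨true, by simpa [edgeLo, edgeHi] using ⟨h, hle⟩⟩
  obtain ⟨r, hr, hrs⟩ := exists_edgeLevel_eq hb
  refine ⟨(l, b), r, hr, Subtype.ext ?_⟩
  rw [coe_treeArc hr, hrs]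
  exact Prod.ext rfl (hll.symm.trans hl'.symm)

theorem locallyFinite_treeArc : LocallyFinite fun i ↦ treeArc i '' Icc (-1) 1 := by
  intro p
  obtain ⟨N, hN⟩ := exists_nat_gt (12 * (|p.1.2| + 2) / π + 1)
  have hopen : IsOpen {q : tree | |q.1.2| < |p.1.2| + 1} := isOpen_lt (by fun_prop) continuous_const
  refine ⟨_, hopen.mem_nhds (lt_add_one |p.1.2|), ?_⟩
  refine ((Set.finite_Icc (-(N : ℤ)) N).prod (Set.finite_univ (α := Bool))).subset ?_
  rintro i ⟨_, ⟨r, hr, rfl⟩, hU⟩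
  rw [mem_ofPred_eq, coe_treeArc hr] at hU
  have hle := le_abs_branch (l := i.1)
    ((edgeLevel_mem_Icc (i := i) hr).2.trans (edgeHi_le_stemTop i))
  have hreal : (i.1.natAbs : ℝ) < N := by
    refine lt_trans ?_ hN
    rw [← sub_lt_iff_lt_add, lt_div_iff₀ pi_pos]
    linarith
  have hnat : i.1.natAbs < N := mod_cast hreal
  refine ⟨⟨?_, ?_⟩, mem_univ _⟩ <;> omega

theorem locallyFinite_treeVertices :
    LocallyFinite fun v : treeVertices ↦ ({(v : tree)} : Set tree) := by
  intro p
  obtain ⟨U, hU, hf⟩ := locallyFinite_treeArc p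
  refine ⟨U, hU, Set.Finite.of_finite_image (f := Subtype.val) ?_ Subtype.val_injective.injOn⟩
  refine ((hf.image fun i ↦ treeArc i (-1)).union (hf.image fun i ↦ treeArc i 1)).subset ?_
  rintro _ ⟨v, ⟨_, rfl, hvU⟩, rfl⟩
  obtain ⟨i, h | h⟩ := exists_eq_treeArc_of_mem_treeVertices v.2
  · exact Or.inl ⟨i, ⟨v, ⟨-1, by simp, h.symm⟩, hvU⟩, h.symm⟩
  · exact Or.inr ⟨i, ⟨v, ⟨1, by simp, h.symm⟩, hvU⟩, h.symm⟩

/-- The graph structure of `tree`. -/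
def treeGraph : ArcDecomposition tree where
  vertices := treeVertices
  ι := ℤ × Bool
  arc := treeArc
  continuousOn_arc i := (continuous_treeArc i).continuousOn
  injOn_arc := injOn_treeArc
  left_mem := treeArc_neg_one_mem_treeVertices
  right_mem := treeArc_one_mem_treeVertices
  arc_notMem _ _ hr := treeArc_notMem_treeVertices hr
  eq_of_arc_eq _ _ _ hr _ hr' h := eq_of_treeArc_eq hr hr' h
  cover p := Or.inr (exists_treeArc_eq p)
  locallyFinite_vertex := locallyFinite_treeVertices
  locallyFinite_arc := locallyFinite_treeArc

instance : Infinite treeGraph.ι := inferInstanceAs (Infinite (ℤ × Bool))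

end TreeGraph

section Criticality

open Real

@[fun_prop]
theorem analyticAt_lower (t : ℝ) : AnalyticAt ℝ lower t := by
  unfold lower
  have hpos : 2 * (t ^ 2 + 1) ≠ 0 := by positivity
  fun_prop (disch := assumption)

@[fun_prop]
theorem analyticAt_upper (t : ℝ) : AnalyticAt ℝ upper t := by
  unfold upper
  have hpos : t ^ 2 + 1 ≠ 0 := by positivity
  fun_prop (disch := assumption)

theorem hasDerivAt_radiusSq (s t : ℝ) :
    HasDerivAt (radiusSq s)
      (-deriv lower t * (upper t - s) + (s - lower t) * deriv upper t) t := by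
  have hl := (hasDerivAt_lower t).differentiableAt.hasDerivAt.const_sub s
  exact hl.mul ((hasDerivAt_upper t).differentiableAt.hasDerivAt.sub_const s)

theorem deriv_lower_neg (t : ℝ) : deriv lower (-t) = -deriv lower t := by
  have h := deriv_comp_neg lower t
  rw [funext lower_neg] at h
  rw [h, neg_neg]

theorem deriv_upper_eq_zero_iff {t : ℝ} : deriv upper t = 0 ↔ t = 0 := by
  have h : (t ^ 2 + 1) ^ 2 ≠ 0 := by positivity
  rw [(hasDerivAt_upper t).deriv, div_eq_zero_iff, or_iff_left h]
  simp

theorem radiusSq_eq_zero_and_deriv_eq_zero_iff {s t : ℝ} :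
    radiusSq s t = 0 ∧ deriv (radiusSq s) t = 0 ↔
      s = lower t ∧ deriv lower t = 0 ∨ s = 1 ∧ t = 0 := by
  have hlt := lower_lt_upper t
  rw [(hasDerivAt_radiusSq s t).deriv, radiusSq, mul_eq_zero, sub_eq_zero, sub_eq_zero]
  constructor
  · rintro ⟨rfl | rfl, hd⟩
    · rw [sub_self, zero_mul, add_zero, neg_mul, neg_eq_zero, mul_eq_zero] at hd
      exact Or.inl ⟨rfl, hd.resolve_right (sub_pos.2 hlt).ne'⟩
    · rw [sub_self, mul_zero, zero_add, mul_eq_zero] at hd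
      obtain rfl := deriv_upper_eq_zero_iff.1 (hd.resolve_left (sub_pos.2 hlt).ne')
      exact Or.inr ⟨upper_zero, rfl⟩
  · rintro (⟨rfl, hd⟩ | ⟨rfl, rfl⟩)
    · simp [hd]
    · simp [upper_zero, deriv_upper_eq_zero_iff.2 rfl]

theorem label_peak (n : ℕ) : label (lower (peak n)) (peak n) = branch n (lower (peak n)) := by
  have h := peak_mem n
  exact ((label_eq_iff h.1).2 fun x hx ↦
    isMaxOn_lower_peak n ⟨hx.1, hx.2.trans h.2.le⟩).symm

theorem exists_label_eq_branch_of_deriv_lower_eq_zero {t : ℝ} (hd : deriv lower t = 0) :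
    ∃ l : ℤ, label (lower t) t = branch l (lower t) ∧
      (lower t = 0 ∨ lower t = stemTop (l.natAbs + 1)) := by
  wlog ht : 0 ≤ t generalizing t
  · obtain ⟨l, hl, hl'⟩ := this (t := -t) (by rw [deriv_lower_neg, hd, neg_zero]) (by linarith)
    rw [lower_neg] at hl hl'
    exact ⟨-l, by rw [branch_neg, ← hl, label_neg, neg_neg], by rwa [Int.natAbs_neg]⟩
  obtain ⟨n, rfl | rfl⟩ := exists_nat_eq_or_eq_peak ht hd
  · exact ⟨n, rfl, Or.inl (lower_nat_mul_pi n)⟩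
  · exact ⟨n, label_peak n, Or.inr rfl⟩

theorem exists_lower_eq_stemTop (l : ℤ) :
    ∃ t, deriv lower t = 0 ∧ lower t = stemTop (l.natAbs + 1) ∧
      label (lower t) t = branch l (lower t) := by
  wlog hl : 0 ≤ l generalizing l
  · obtain ⟨t, hd, ht, ht'⟩ := this (-l) (by omega)
    refine ⟨-t, by rw [deriv_lower_neg, hd, neg_zero], by rw [lower_neg, ht, Int.natAbs_neg], ?_⟩
    rw [lower_neg, label_neg, ht', branch_neg, neg_neg]
  obtain ⟨n, rfl⟩ := Int.eq_ofNat_of_zero_le hl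
  exact ⟨peak n, deriv_lower_peak n, rfl, label_peak n⟩

theorem deriv_lower_int_mul_pi (l : ℤ) : deriv lower (l * π) = 0 := by
  rw [(hasDerivAt_lower _).deriv, sin_int_mul_pi]
  simp

theorem mem_treeVertices_iff {p : tree} :
    p ∈ treeVertices ↔ ∃ s t, radiusSq s t = 0 ∧ deriv (radiusSq s) t = 0 ∧
      (p : ℝ × ℝ) = (s, label s t) := by
  simp_rw [← and_assoc, radiusSq_eq_zero_and_deriv_eq_zero_iff]
  constructor
  · rintro ⟨l, hl, hb, hs | hs | hs⟩
    · have h0 := lower_int_mul_pi l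
      refine ⟨_, l * π, Or.inl ⟨rfl, deriv_lower_int_mul_pi l⟩, Prod.ext (hs.trans h0.symm) ?_⟩
      rw [hb, hs, h0]
      rfl
    · obtain ⟨t, hd, ht, hlabel⟩ := exists_lower_eq_stemTop l
      refine ⟨_, t, Or.inl ⟨rfl, hd⟩, Prod.ext (hs.trans ht.symm) ?_⟩
      rw [hb, hs, ← ht, hlabel]
    · obtain rfl : l = 0 := hl.resolve_right fun hlt ↦ (hlt.trans_le (stemTop_le_one _)).ne hs
      refine ⟨1, 0, Or.inr ⟨rfl, rfl⟩, Prod.ext hs ?_⟩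
      rw [hb, branch_zero, label_zero]
  · rintro ⟨s, t, ⟨rfl, hd⟩ | ⟨rfl, rfl⟩, hp⟩
    · obtain ⟨l, hl, hl'⟩ := exists_label_eq_branch_of_deriv_lower_eq_zero hd
      exact mem_treeVertices_of_branch (l := l) (by rw [hp, hl]) (by rwa [hp])
    · refine ⟨0, Or.inl rfl, ?_, Or.inr (Or.inr (by rw [hp]))⟩
      rw [hp, branch_zero, label_zero]

end Criticality

section ZeroSet

variable {n : ℕ}

/-- The point with coordinates `(x₁, x₂, y₁, …, yₙ)`. -/
def mkPoint (s t : ℝ) (y : Fin n → ℝ) : EuclideanSpace ℝ (Fin (n + 2)) :=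
  WithLp.toLp 2 (Fin.cons s (Fin.cons t y))

theorem eq_mkPoint_iff {x : EuclideanSpace ℝ (Fin (n + 2))} {s t : ℝ} {y : Fin n → ℝ} :
    x = mkPoint s t y ↔ x 0 = s ∧ x 1 = t ∧ ∀ i : Fin n, x i.succ.succ = y i := by
  refine ⟨by rintro rfl; exact ⟨rfl, rfl, fun _ ↦ rfl⟩, fun ⟨h0, h1, h2⟩ ↦ ?_⟩
  ext j
  exact Fin.cases h0 (Fin.cases h1 h2) j

theorem definingFun_eq (x : EuclideanSpace ℝ (Fin (n + 2))) :
    definingFun (n + 1) x = radiusSq (x 0) (x 1) - ∑ i : Fin n, x i.succ.succ ^ 2 := by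
  have hsum : ∑ j : Fin (n + 1 + 1) with 2 ≤ j.val, x j ^ 2 = ∑ i : Fin n, x i.succ.succ ^ 2 := by
    rw [Finset.sum_filter, Fin.sum_univ_succ, Fin.sum_univ_succ]
    simp
  unfold definingFun
  rw [hsum]
  rfl

theorem mem_zeroSet_iff {x : EuclideanSpace ℝ (Fin (n + 2))} :
    x ∈ zeroSet (n + 1) ↔ ∑ i : Fin n, x i.succ.succ ^ 2 = radiusSq (x 0) (x 1) := by
  change definingFun (n + 1) x = 0 ↔ _
  rw [definingFun_eq, sub_eq_zero, eq_comm]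

theorem mem_region_of_mem_zeroSet {x : EuclideanSpace ℝ (Fin (n + 2))} (hx : x ∈ zeroSet (n + 1)) :
    (x 0, x 1) ∈ region := by
  rw [← radiusSq_nonneg_iff, ← mem_zeroSet_iff.1 hx]
  positivity

theorem forall_eq_zero_iff_of_mem_zeroSet {x : EuclideanSpace ℝ (Fin (n + 2))}
    (hx : x ∈ zeroSet (n + 1)) : (∀ i : Fin n, x i.succ.succ = 0) ↔ radiusSq (x 0) (x 1) = 0 := by
  rw [← mem_zeroSet_iff.1 hx, Finset.sum_eq_zero_iff_of_nonneg fun _ _ ↦ sq_nonneg _]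
  simp

theorem analyticOnNhd_definingFun (m : ℕ) : AnalyticOnNhd ℝ (definingFun m) univ := by
  intro x _
  have hcoord : ∀ i, AnalyticAt ℝ (fun x : EuclideanSpace ℝ (Fin (m + 1)) ↦ x i) x := fun i ↦
    (EuclideanSpace.proj i : EuclideanSpace ℝ (Fin (m + 1)) →L[ℝ] ℝ).analyticAt x
  have hlower : AnalyticAt ℝ (fun x : EuclideanSpace ℝ (Fin (m + 1)) ↦ lower (x 1)) x :=
    AnalyticAt.comp (g := lower) (analyticAt_lower (x 1)) (hcoord 1)
  have hupper : AnalyticAt ℝ (fun x : EuclideanSpace ℝ (Fin (m + 1)) ↦ upper (x 1)) x :=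
    AnalyticAt.comp (g := upper) (analyticAt_upper (x 1)) (hcoord 1)
  exact (((hcoord 0).sub hlower).mul (hupper.sub (hcoord 0))).sub
    (Finset.analyticAt_fun_sum _ fun i _ ↦ (hcoord i).pow 2)

theorem contDiff_definingFun (m : ℕ) : ContDiff ℝ ∞ (definingFun m) :=
  (analyticOnNhd_definingFun m).contDiff

theorem isClosed_zeroSet (m : ℕ) : IsClosed (zeroSet m) :=
  isClosed_eq (contDiff_definingFun m).continuous continuous_const

theorem hasDerivAt_radiusSq_comp {f g : ℝ → ℝ} {f' g' u : ℝ} (hf : HasDerivAt f f' u)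
    (hg : HasDerivAt g g' u) :
    HasDerivAt (fun u ↦ radiusSq (f u) (g u))
      ((upper (g u) + lower (g u) - 2 * f u) * f' + deriv (radiusSq (f u)) (g u) * g') u := by
  have hl := (hasDerivAt_lower (g u)).differentiableAt.hasDerivAt.comp u hg
  have hu := (hasDerivAt_upper (g u)).differentiableAt.hasDerivAt.comp u hg
  refine ((hf.sub hl).mul (hu.sub hf)).congr_deriv ?_
  rw [(hasDerivAt_radiusSq _ _).deriv]
  simp only [Pi.sub_apply, Function.comp_apply]
  ring

theorem fderiv_definingFun (x v : EuclideanSpace ℝ (Fin (n + 2))) :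
    fderiv ℝ (definingFun (n + 1)) x v =
      (upper (x 1) + lower (x 1) - 2 * x 0) * v 0 + deriv (radiusSq (x 0)) (x 1) * v 1 -
        ∑ i : Fin n, 2 * x i.succ.succ * v i.succ.succ := by
  have hline : HasLineDerivAt ℝ (definingFun (n + 1)) (fderiv ℝ (definingFun (n + 1)) x v) x v :=
    ((contDiff_definingFun (n + 1)).differentiable (by simp) x).hasFDerivAt.hasLineDerivAt v
  have hcoord : ∀ j, HasDerivAt (fun u : ℝ ↦ x j + u * v j) (v j) 0 := fun j ↦ by
    simpa using ((hasDerivAt_id (0 : ℝ)).mul_const (v j)).const_add (x j)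
  have hsum : HasDerivAt (fun u : ℝ ↦ ∑ i : Fin n, (x i.succ.succ + u * v i.succ.succ) ^ 2)
      (∑ i : Fin n, 2 * x i.succ.succ * v i.succ.succ) 0 :=
    HasDerivAt.fun_sum fun i _ ↦ ((hcoord i.succ.succ).pow 2).congr_deriv (by simp)
  have hexplicit := (hasDerivAt_radiusSq_comp (hcoord 0) (hcoord 1)).sub hsum
  simp only [zero_mul, add_zero] at hexplicit
  refine HasDerivAt.unique hline (hexplicit.congr_of_eventuallyEq (.of_forall fun u ↦ ?_))
  simp only [definingFun_eq]
  rfl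

theorem fderiv_definingFun_mkPoint (x : EuclideanSpace ℝ (Fin (n + 2))) (a b : ℝ)
    (y : Fin n → ℝ) :
    fderiv ℝ (definingFun (n + 1)) x (mkPoint a b y) =
      (upper (x 1) + lower (x 1) - 2 * x 0) * a + deriv (radiusSq (x 0)) (x 1) * b -
        ∑ i : Fin n, 2 * x i.succ.succ * y i :=
  fderiv_definingFun x _

theorem upper_add_lower_sub_ne_zero {s t : ℝ} (h : radiusSq s t = 0) :
    upper t + lower t - 2 * s ≠ 0 := by
  have := lower_lt_upper t
  rcases mul_eq_zero.1 h with h | h <;> intro h' <;> linarith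

theorem fderiv_definingFun_ne_zero {x : EuclideanSpace ℝ (Fin (n + 2))} (hx : x ∈ zeroSet (n + 1)) :
    fderiv ℝ (definingFun (n + 1)) x ≠ 0 := by
  intro h
  have hy : ∀ i : Fin n, x i.succ.succ = 0 := fun i ↦ by
    simpa [h, Pi.single_apply] using fderiv_definingFun_mkPoint x 0 0 (Pi.single i 1)
  refine upper_add_lower_sub_ne_zero ((forall_eq_zero_iff_of_mem_zeroSet hx).1 hy) ?_
  simpa [h] using (fderiv_definingFun_mkPoint x 1 0 0).symm

theorem isRegularZero_definingFun (n : ℕ) :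
    IsRegularZero (EuclideanSpace ℝ (Fin (n + 1))) (definingFun (n + 1)) where
  finrank_add_finrank := by simp
  contDiff := contDiff_definingFun _
  surjective_fderiv _ hx := LinearMap.surjective_iff_ne_zero.2 fun h ↦
    fderiv_definingFun_ne_zero hx (ContinuousLinearMap.coe_injective h)

/-- The manifold structure on the hypersurface. -/
@[reducible]
def zeroSetChartedSpace (n : ℕ) :
    ChartedSpace (EuclideanSpace ℝ (Fin (n + 1))) (zeroSet (n + 1)) :=
  (isRegularZero_definingFun n).chartedSpace

theorem isManifold_zeroSet (n : ℕ) :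
    let _ := zeroSetChartedSpace n
    IsManifold (𝓡 (n + 1)) ∞ (zeroSet (n + 1)) :=
  (isRegularZero_definingFun n).isManifold

theorem isSmoothEmbedding_zeroSet_val (n : ℕ) :
    let _ := zeroSetChartedSpace n
    IsSmoothEmbedding (𝓡 (n + 1)) 𝓘(ℝ, EuclideanSpace ℝ (Fin (n + 2))) ∞
      (Subtype.val : zeroSet (n + 1) → EuclideanSpace ℝ (Fin (n + 2))) :=
  (isRegularZero_definingFun n).isSmoothEmbedding_val

theorem contMDiff_firstCoord (n : ℕ) :
    let _ := zeroSetChartedSpace n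
    ContMDiff (𝓡 (n + 1)) 𝓘(ℝ, ℝ) ∞ (firstCoord (n + 1)) := by
  let _ := zeroSetChartedSpace n
  have hproj := (EuclideanSpace.proj 0 : EuclideanSpace ℝ (Fin (n + 2)) →L[ℝ] ℝ).contDiff (n := ∞)
  exact hproj.contMDiff.comp (isSmoothEmbedding_zeroSet_val n).contMDiff

theorem forall_fderiv_definingFun_eq_zero_iff {x : EuclideanSpace ℝ (Fin (n + 2))}
    (hx : x ∈ zeroSet (n + 1)) :
    (∀ v, fderiv ℝ (definingFun (n + 1)) x v = 0 → v 0 = 0) ↔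
      radiusSq (x 0) (x 1) = 0 ∧ deriv (radiusSq (x 0)) (x 1) = 0 := by
  rw [← forall_eq_zero_iff_of_mem_zeroSet hx]
  set α := upper (x 1) + lower (x 1) - 2 * x 0 with hα
  set β := deriv (radiusSq (x 0)) (x 1) with hβ
  constructor
  · intro h
    constructor
    · intro i
      have hi : 2 * x i.succ.succ = 0 := h (mkPoint (2 * x i.succ.succ) 0 (Pi.single i α)) (by
        rw [fderiv_definingFun_mkPoint, ← hα]
        simp [Pi.single_apply]
        ring)
      simpa using hi
    · exact h (mkPoint β (-α) 0) (by
        rw [fderiv_definingFun_mkPoint, ← hα, ← hβ]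
        simp only [Pi.zero_apply, mul_zero, Finset.sum_const_zero]
        ring)
  · rintro ⟨hy, hβ0⟩ v hv
    have hα0 : α ≠ 0 :=
      upper_add_lower_sub_ne_zero ((forall_eq_zero_iff_of_mem_zeroSet hx).1 hy)
    rw [fderiv_definingFun, ← hα, ← hβ, hβ0] at hv
    simpa [hy, hα0] using hv

theorem mem_criticalPoints_iff (x : zeroSet (n + 1)) :
    let _ := zeroSetChartedSpace n
    x ∈ criticalPoints (m := n + 1) (firstCoord (n + 1)) ↔
      radiusSq (x.1 0) (x.1 1) = 0 ∧ deriv (radiusSq (x.1 0)) (x.1 1) = 0 := by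
  let _ := zeroSetChartedSpace n
  let proj : EuclideanSpace ℝ (Fin (n + 2)) →L[ℝ] ℝ := EuclideanSpace.proj 0
  have h := (isRegularZero_definingFun n).mfderiv_comp_val_eq_zero_iff x proj.differentiableAt
  simp only [proj.fderiv] at h
  exact h.trans (forall_fderiv_definingFun_eq_zero_iff x.2)

end ZeroSet

section Connectedness

variable {n : ℕ}

theorem mkPoint_mem_zeroSet_iff {s t : ℝ} {y : Fin n → ℝ} :
    mkPoint s t y ∈ zeroSet (n + 1) ↔ ∑ i, y i ^ 2 = radiusSq s t := mem_zeroSet_iff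

theorem mkPoint_zero_mem_zeroSet {s t : ℝ} (h : radiusSq s t = 0) :
    (mkPoint s t 0 : EuclideanSpace ℝ (Fin (n + 2))) ∈ zeroSet (n + 1) := by
  simp [mkPoint_mem_zeroSet_iff, h]

/-- The section of the projection of `zeroSet` to `region` in the direction of the unit
vector `w`. -/
def sectionAt (w : Fin n → ℝ) (p : ℝ × ℝ) : EuclideanSpace ℝ (Fin (n + 2)) :=
  mkPoint p.1 p.2 fun i ↦ √(radiusSq p.1 p.2) * w i

theorem continuous_mkPoint {X : Type*} [TopologicalSpace X] {f g : X → ℝ} {y : X → Fin n → ℝ}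
    (hf : Continuous f) (hg : Continuous g) (hy : Continuous y) :
    Continuous fun x ↦ mkPoint (f x) (g x) (y x) :=
  (PiLp.continuous_toLp 2 _).comp (hf.finCons (hg.finCons hy))

theorem continuous_sectionAt (w : Fin n → ℝ) : Continuous (sectionAt w) :=
  continuous_mkPoint continuous_fst continuous_snd (by fun_prop)

theorem sectionAt_mem_zeroSet {w : Fin n → ℝ} (hw : ∑ i, w i ^ 2 = 1) {p : ℝ × ℝ}
    (hp : p ∈ region) : sectionAt w p ∈ zeroSet (n + 1) := by
  simp only [sectionAt, mkPoint_mem_zeroSet_iff, mul_pow, ← Finset.mul_sum, hw, mul_one]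
  exact Real.sq_sqrt (radiusSq_nonneg_iff.2 hp)

theorem sectionAt_of_radiusSq_eq_zero (w : Fin n → ℝ) {p : ℝ × ℝ} (hp : radiusSq p.1 p.2 = 0) :
    sectionAt w p = mkPoint p.1 p.2 0 := by
  simp only [sectionAt, hp, Real.sqrt_zero, zero_mul]
  rfl

theorem exists_sum_sq_eq_one (hn : 0 < n) : ∃ w : Fin n → ℝ, ∑ i, w i ^ 2 = 1 :=
  ⟨Pi.single ⟨0, hn⟩ 1, by simp [Pi.single_apply]⟩

theorem exists_eq_sectionAt (hn : 0 < n) {x : EuclideanSpace ℝ (Fin (n + 2))}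
    (hx : x ∈ zeroSet (n + 1)) :
    ∃ w : Fin n → ℝ, ∑ i, w i ^ 2 = 1 ∧ x = sectionAt w (x 0, x 1) := by
  have hsum := mem_zeroSet_iff.1 hx
  rcases (radiusSq_nonneg_iff.2 (mem_region_of_mem_zeroSet hx)).eq_or_lt with h | h
  · obtain ⟨w, hw⟩ := exists_sum_sq_eq_one hn
    refine ⟨w, hw, ?_⟩
    rw [sectionAt_of_radiusSq_eq_zero w h.symm, eq_mkPoint_iff]
    exact ⟨rfl, rfl, (forall_eq_zero_iff_of_mem_zeroSet hx).2 h.symm⟩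
  · refine ⟨fun i ↦ x i.succ.succ / √(radiusSq (x 0) (x 1)), ?_, ?_⟩
    · simp only [div_pow, Real.sq_sqrt h.le, ← Finset.sum_div, hsum]
      exact div_self h.ne'
    · exact eq_mkPoint_iff.2
        ⟨rfl, rfl, fun i ↦ (mul_div_cancel₀ _ (Real.sqrt_pos.2 h).ne').symm⟩

theorem isPreconnected_zeroSet_inter_preimage (hn : 0 < n) {P : Set (ℝ × ℝ)}
    (hP : IsPreconnected P) (hsub : P ⊆ region) {p₀ : ℝ × ℝ} (hp₀ : p₀ ∈ P)
    (h₀ : radiusSq p₀.1 p₀.2 = 0) :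
    IsPreconnected (zeroSet (n + 1) ∩ (fun x ↦ (x 0, x 1)) ⁻¹' P) := by
  -- All sections pass through the same point over `p₀`.
  refine isPreconnected_of_forall (mkPoint p₀.1 p₀.2 0) fun x hx ↦ ?_
  obtain ⟨w, hw, hxw⟩ := exists_eq_sectionAt hn hx.1
  refine ⟨sectionAt w '' P, image_subset_iff.2 fun p hp ↦ ?_, ?_, ?_, ?_⟩
  · exact ⟨sectionAt_mem_zeroSet hw (hsub hp), hp⟩
  · exact ⟨p₀, hp₀, sectionAt_of_radiusSq_eq_zero w h₀⟩
  · exact ⟨_, hx.2, hxw.symm⟩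
  · exact hP.image _ (continuous_sectionAt w).continuousOn

theorem isPreconnected_region : IsPreconnected region := by
  have h : region = (fun q : ℝ × ℝ ↦ (AffineMap.lineMap (lower q.1) (upper q.1) q.2, q.1)) ''
      (univ ×ˢ Icc 0 1) := by
    ext ⟨s, t⟩
    change s ∈ Icc (lower t) (upper t) ↔ _
    rw [← segment_eq_Icc (lower_lt_upper t).le, segment_eq_image_lineMap]
    constructor
    · rintro ⟨r, hr, rfl⟩
      exact ⟨(t, r), ⟨mem_univ t, hr⟩, rfl⟩
    · rintro ⟨⟨t', r⟩, ⟨-, hr⟩, hst⟩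
      obtain ⟨rfl, rfl⟩ := Prod.mk.inj hst
      exact ⟨r, hr, rfl⟩
  rw [h]
  refine (isPreconnected_univ.prod isPreconnected_Icc).image _ (Continuous.continuousOn ?_)
  simp only [AffineMap.lineMap_apply_module]
  fun_prop

theorem radiusSq_one_zero : radiusSq 1 0 = 0 := by simp [radiusSq, upper_zero]

theorem isConnected_zeroSet (hn : 0 < n) : IsConnected (zeroSet (n + 1)) := by
  refine ⟨⟨_, mkPoint_zero_mem_zeroSet radiusSq_one_zero⟩, ?_⟩
  have h := isPreconnected_zeroSet_inter_preimage hn isPreconnected_region subset_rfl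
    (p₀ := (1, 0)) (radiusSq_nonneg_iff.1 radiusSq_one_zero.ge) radiusSq_one_zero
  have hsub : zeroSet (n + 1) ⊆ (fun x ↦ (x 0, x 1)) ⁻¹' region :=
    fun _ ↦ mem_region_of_mem_zeroSet
  rwa [inter_eq_left.2 hsub] at h

theorem continuous_coord (j : Fin (n + 2)) : Continuous fun x : zeroSet (n + 1) ↦ x.1 j := by
  fun_prop

theorem not_isCompact_zeroSet : ¬ IsCompact (zeroSet (n + 1)) := by
  intro h
  obtain ⟨B, hB⟩ := (h.image (f := fun x : EuclideanSpace ℝ (Fin (n + 2)) ↦ x 1)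
    (by fun_prop)).bddAbove
  obtain ⟨k, hk⟩ := exists_nat_gt (B / Real.pi)
  have hs : radiusSq 0 (k * Real.pi) = 0 := by simp [radiusSq, lower_nat_mul_pi]
  have hkB : k * Real.pi ≤ B := hB ⟨_, mkPoint_zero_mem_zeroSet hs, rfl⟩
  exact hkB.not_gt ((div_lt_iff₀ Real.pi_pos).1 hk)

end Connectedness

section Contours

variable {n : ℕ}

/-- The map from the hypersurface to the plane whose fibres are the contours of the first
coordinate. -/
def toTree (x : zeroSet (n + 1)) : tree :=
  ⟨(x.1 0, label (x.1 0) (x.1 1)), image_region.subset ⟨_, mem_region_of_mem_zeroSet x.2, rfl⟩⟩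

theorem continuous_toTree : Continuous (toTree (n := n)) :=
  ((continuous_coord 0).prodMk
    (continuous_label.comp ((continuous_coord 0).prodMk (continuous_coord 1)))).subtype_mk _

theorem surjective_toTree (hn : 0 < n) : Function.Surjective (toTree (n := n)) := by
  rintro ⟨p, hp⟩
  obtain ⟨q, hq, rfl⟩ := image_region.superset hp
  obtain ⟨w, hw⟩ := exists_sum_sq_eq_one hn
  exact ⟨⟨sectionAt w q, sectionAt_mem_zeroSet hw hq⟩, rfl⟩

theorem toTree_eq_iff {x y : zeroSet (n + 1)} :
    toTree x = toTree y ↔ y.1 0 = x.1 0 ∧ y.1 1 ∈ fiber (x.1 0) (label (x.1 0) (x.1 1)) := by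
  have hy := mem_region_of_mem_zeroSet y.2
  rw [toTree, toTree, Subtype.mk.injEq, Prod.mk.injEq, eq_comm]
  constructor
  · rintro ⟨h0, h1⟩
    rw [h0] at hy h1
    exact ⟨h0, hy, h1.symm⟩
  · rintro ⟨h0, -, h1⟩
    exact ⟨h0, by rw [h0, h1]⟩

theorem toTree_eq_of_mem_contour {x y : zeroSet (n + 1)}
    (hy : y ∈ contour (firstCoord (n + 1)) x) : toTree x = toTree y := by
  have h0 : ∀ z ∈ contour (firstCoord (n + 1)) x, z.1 0 = x.1 0 :=
    fun z hz ↦ connectedComponentIn_subset _ x hz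
  have hord : ((fun z : zeroSet (n + 1) ↦ z.1 1) ''
      contour (firstCoord (n + 1)) x).OrdConnected :=
    (isPreconnected_connectedComponentIn.image _ (continuous_coord 1).continuousOn).ordConnected
  refine toTree_eq_iff.2 ⟨h0 y hy, ?_, label_eq_of_forall_lower_le fun t ht ↦ ?_⟩
  · exact h0 y hy ▸ mem_region_of_mem_zeroSet y.2
  · obtain ⟨z, hz, rfl⟩ := hord.uIcc_subset (mem_image_of_mem _ hy)
      (mem_image_of_mem _ (mem_contour_self _ x)) ht
    exact h0 z hz ▸ (mem_region_of_mem_zeroSet z.2).1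

theorem mem_contour_of_toTree_eq (hn : 0 < n) {x y : zeroSet (n + 1)} (h : toTree x = toTree y) :
    y ∈ contour (firstCoord (n + 1)) x := by
  set P : Set (ℝ × ℝ) := {x.1 0} ×ˢ fiber (x.1 0) (label (x.1 0) (x.1 1))
  have hmem : ∀ z : zeroSet (n + 1), toTree x = toTree z → (z.1 0, z.1 1) ∈ P :=
    fun z hz ↦ toTree_eq_iff.1 hz
  obtain ⟨a, b, hab, hI, ha, -⟩ := exists_fiber_eq_Icc ⟨x.1 1, (hmem x rfl).2⟩
  have hP : IsPreconnected P :=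
    isPreconnected_singleton.prod (ordConnected_fiber _ _).isPreconnected
  have hsub : P ⊆ region := by
    rintro ⟨s, t⟩ ⟨rfl, ht, -⟩
    exact ht
  have haP : (x.1 0, a) ∈ P := ⟨rfl, hI ▸ left_mem_Icc.2 hab⟩
  have hZ : IsPreconnected ((fun z : zeroSet (n + 1) ↦ (z.1 0, z.1 1)) ⁻¹' P) := by
    rw [← IsEmbedding.subtypeVal.isInducing.isPreconnected_image]
    have himage := Subtype.image_preimage_coe (zeroSet (n + 1)) ((fun z ↦ (z 0, z 1)) ⁻¹' P)
    exact himage ▸ isPreconnected_zeroSet_inter_preimage hn hP hsub haP ha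
  exact hZ.subset_connectedComponentIn (hmem x rfl) (fun z hz ↦ hz.1) (hmem y h)

theorem mem_contour_iff (hn : 0 < n) {x y : zeroSet (n + 1)} :
    y ∈ contour (firstCoord (n + 1)) x ↔ toTree x = toTree y :=
  ⟨toTree_eq_of_mem_contour, mem_contour_of_toTree_eq hn⟩

theorem norm_sq_eq_of_mem_zeroSet {x : EuclideanSpace ℝ (Fin (n + 2))}
    (hx : x ∈ zeroSet (n + 1)) : ‖x‖ ^ 2 = x 0 ^ 2 + x 1 ^ 2 + radiusSq (x 0) (x 1) := by
  rw [EuclideanSpace.real_norm_sq_eq, Fin.sum_univ_succ, Fin.sum_univ_succ,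
    mem_zeroSet_iff.1 hx, ← add_assoc]
  rfl

theorem radiusSq_le_one {s t : ℝ} (h : (s, t) ∈ region) : radiusSq s t ≤ 1 := by
  obtain ⟨h0, h1⟩ := fst_mem_Icc_of_mem_region h
  have hl := lower_nonneg t
  have hu := upper_le_one t
  exact mul_le_one₀ (by linarith) (sub_nonneg.2 h.2) (by linarith)

theorem isCompact_preimage_toTree {T : Set tree} (hT : IsCompact T) :
    IsCompact (toTree (n := n) ⁻¹' T) := by
  rw [IsEmbedding.subtypeVal.isCompact_iff]
  obtain ⟨C, hC⟩ := (hT.image (f := fun q : tree ↦ |q.1.2|) (by fun_prop)).bddAbove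
  refine Metric.isCompact_of_isClosed_isBounded ?_ (isBounded_iff_forall_norm_le.2
    ⟨√(1 + (12 * (C + 1)) ^ 2 + 1), ?_⟩)
  · exact (isClosed_zeroSet _).isClosedEmbedding_subtypeVal.isClosedMap _
      (hT.isClosed.preimage continuous_toTree)
  · rintro _ ⟨x, hx, rfl⟩
    have hr := mem_region_of_mem_zeroSet x.2
    have h0 : x.1 0 ^ 2 ≤ 1 :=
      pow_le_one₀ (fst_mem_Icc_of_mem_region hr).1 (fst_mem_Icc_of_mem_region hr).2
    have h1 : x.1 1 ^ 2 ≤ (12 * (C + 1)) ^ 2 :=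
      sq_le_sq.2 ((abs_le_of_abs_label_le hr (hC ⟨_, hx, rfl⟩)).trans (le_abs_self _))
    apply Real.le_sqrt_of_sq_le
    rw [norm_sq_eq_of_mem_zeroSet x.2]
    exact add_le_add (add_le_add h0 h1) (radiusSq_le_one hr)

theorem isQuotientMap_toTree (hn : 0 < n) : IsQuotientMap (toTree (n := n)) :=
  IsClosedMap.isQuotientMap (isProperMap_iff_isCompact_preimage.2
    ⟨continuous_toTree, fun _ hT ↦ isCompact_preimage_toTree hT⟩).isClosedMap
    continuous_toTree (surjective_toTree hn)

/-- The Reeb space of the first coordinate is homeomorphic to `tree`. -/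
def reebHomeomorph (hn : 0 < n) : tree ≃ₜ ReebSpace (firstCoord (n + 1)) :=
  (Homeomorph.Quotient.congrRight (r := Setoid.ker toTree)
    (r' := contourSetoid (firstCoord (n + 1))) fun _ _ ↦ (mem_contour_iff hn).symm).symm.trans
    (IsQuotientMap.homeomorph (f := ⟨toTree, continuous_toTree⟩)
      (isQuotientMap_toTree hn)) |>.symm

theorem reebHomeomorph_toTree (hn : 0 < n) (x : zeroSet (n + 1)) :
    reebHomeomorph hn (toTree x) = quotientMap (firstCoord (n + 1)) x := by
  have h : (reebHomeomorph hn).symm (quotientMap (firstCoord (n + 1)) x) = toTree x := rfl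
  rw [← h, Homeomorph.apply_symm_apply]

theorem isCompact_preimage_quotientMap (hn : 0 < n) {T : Set (ReebSpace (firstCoord (n + 1)))}
    (hT : IsCompact T) : IsCompact (quotientMap (firstCoord (n + 1)) ⁻¹' T) := by
  rw [← funext (reebHomeomorph_toTree hn)]
  exact isCompact_preimage_toTree ((reebHomeomorph hn).isCompact_preimage.2 hT)

theorem image_quotientMap_criticalPoints (hn : 0 < n) :
    let _ := zeroSetChartedSpace n
    quotientMap (firstCoord (n + 1)) '' criticalPoints (m := n + 1) (firstCoord (n + 1)) =
      reebHomeomorph hn '' treeVertices := by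
  let _ := zeroSetChartedSpace n
  have h : toTree '' criticalPoints (m := n + 1) (firstCoord (n + 1)) = treeVertices := by
    ext p
    rw [mem_treeVertices_iff]
    constructor
    · rintro ⟨x, hx, rfl⟩
      obtain ⟨hz, hd⟩ := (mem_criticalPoints_iff x).1 hx
      exact ⟨_, _, hz, hd, rfl⟩
    · rintro ⟨s, t, hz, hd, hp⟩
      exact ⟨⟨mkPoint s t 0, mkPoint_zero_mem_zeroSet hz⟩, (mem_criticalPoints_iff _).2 ⟨hz, hd⟩,
        Subtype.ext hp.symm⟩
  rw [← h, image_image]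
  exact image_congr fun x _ ↦ (reebHomeomorph_toTree hn x).symm

end Contours

section SimpleZeros

theorem analyticOnNhd_dslope {h : ℝ → ℝ} (hh : AnalyticOnNhd ℝ h univ) (a : ℝ) :
    AnalyticOnNhd ℝ (dslope h a) univ := by
  intro t _
  rcases eq_or_ne t a with rfl | hta
  · obtain ⟨p, hp⟩ := hh t (mem_univ t)
    exact ⟨_, hp.has_fpower_series_dslope_fslope⟩
  · have hinv : AnalyticAt ℝ (fun x ↦ (x - a)⁻¹) t := by fun_prop (disch := grind)
    refine (hinv.smul ((hh t (mem_univ t)).sub (analyticAt_const (v := h a)))).congr ?_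
    filter_upwards [isOpen_ne.mem_nhds hta] with x hx
    exact (dslope_of_ne _ hx).symm

theorem exists_eq_mul_of_zeros {h : ℝ → ℝ} (hh : AnalyticOnNhd ℝ h univ) {a b : ℝ}
    (hab : a ≠ b) (ha : h a = 0) (hb : h b = 0) :
    ∃ k : ℝ → ℝ, AnalyticOnNhd ℝ k univ ∧ ∀ t, h t = (t - a) * (b - t) * k t := by
  have hga : ∀ t, (t - a) * dslope h a t = h t := fun t ↦ by
    simpa only [smul_eq_mul, ha, sub_zero] using sub_smul_dslope h a t
  have hgb : dslope h a b = 0 :=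
    (mul_eq_zero.1 ((hga b).trans hb)).resolve_left (sub_ne_zero.2 hab.symm)
  have hk : ∀ t, (t - b) * dslope (dslope h a) b t = dslope h a t := fun t ↦ by
    simpa only [smul_eq_mul, hgb, sub_zero] using sub_smul_dslope (dslope h a) b t
  refine ⟨-dslope (dslope h a) b, (analyticOnNhd_dslope (analyticOnNhd_dslope hh a) b).neg,
    fun t ↦ ?_⟩
  rw [← hga t, ← hk t, Pi.neg_apply]
  ring

theorem deriv_mul_of_zeros {h k : ℝ → ℝ} {a b t : ℝ} (hk : DifferentiableAt ℝ k t)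
    (hfac : ∀ t, h t = (t - a) * (b - t) * k t) :
    deriv h t = (b - t) * k t - (t - a) * k t + (t - a) * (b - t) * deriv k t := by
  have hd := (((hasDerivAt_id t).sub_const a).mul ((hasDerivAt_id t).const_sub b)).mul hk.hasDerivAt
  rw [funext hfac]
  refine (hd.congr_deriv ?_).deriv
  simp only [id, Pi.mul_apply]
  ring

theorem pos_of_eq_mul_of_deriv_ne_zero {h k : ℝ → ℝ} (hk : Differentiable ℝ k) {a b : ℝ}
    (hab : a < b) (hfac : ∀ t, h t = (t - a) * (b - t) * k t) (hda : deriv h a ≠ 0)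
    (hdb : deriv h b ≠ 0) (hpos : ∀ t ∈ Ioo a b, 0 < h t) {t : ℝ} (ht : t ∈ Icc a b) :
    0 < k t := by
  have hIoo : ∀ t ∈ Ioo a b, 0 < k t := fun t ht ↦
    pos_of_mul_pos_right (hfac t ▸ hpos t ht) (mul_pos (sub_pos.2 ht.1) (sub_pos.2 ht.2)).le
  have hIcc : Icc a b ⊆ {t | 0 ≤ k t} := closure_Ioo hab.ne ▸
    closure_minimal (fun t ht ↦ (hIoo t ht).le) (isClosed_le continuous_const hk.continuous)
  refine (hIcc ht).lt_of_ne' fun h0 ↦ ?_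
  have hd := deriv_mul_of_zeros (hk t) hfac
  rcases ht.1.eq_or_lt with rfl | hta
  · exact hda (by simp [hd, h0])
  rcases ht.2.eq_or_lt with rfl | htb
  · exact hdb (by simp [hd, h0])
  · exact (hIoo t ⟨hta, htb⟩).ne' h0

theorem exists_uIcc_nonneg_of_deriv_ne_zero {f : ℝ → ℝ} {a : ℝ} (ha : f a = 0)
    (hd : deriv f a ≠ 0) : ∃ u ≠ a, ∀ t ∈ uIcc a u, 0 ≤ f t := by
  have huIcc : ∀ {p : ℝ → Prop}, (∀ᶠ t in 𝓝 a, p t) → ∀ᶠ u in 𝓝 a, ∀ t ∈ uIcc a u, p t :=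
    fun hp ↦ (tendsto_const_nhds.uIcc Filter.tendsto_id).eventually hp.smallSets
  rcases hd.lt_or_gt with hneg | hpos
  · have hev := huIcc (eventually_nhdsWithin_sign_eq_of_deriv_neg hneg ha)
    obtain ⟨u, hu, hua⟩ := Filter.Eventually.exists (f := 𝓝[<] a)
      ((hev.filter_mono nhdsWithin_le_nhds).and self_mem_nhdsWithin)
    refine ⟨u, hua.ne, fun t ht ↦ ?_⟩
    rw [← sign_nonneg_iff, hu t ht, sign_nonneg_iff, sub_nonneg]
    exact (uIcc_of_ge hua.le ▸ ht).2
  · have hev := huIcc (eventually_nhdsWithin_sign_eq_of_deriv_pos hpos ha)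
    obtain ⟨u, hu, hua⟩ := Filter.Eventually.exists (f := 𝓝[>] a)
      ((hev.filter_mono nhdsWithin_le_nhds).and self_mem_nhdsWithin)
    refine ⟨u, hua.ne', fun t ht ↦ ?_⟩
    rw [← sign_nonneg_iff, hu t ht, sign_nonneg_iff, sub_nonneg]
    exact (uIcc_of_le hua.le ▸ ht).1

end SimpleZeros

section RegularContours

variable {n : ℕ}

theorem isDiffeomorphicToSphere_of_leftInverse
    {f : EuclideanSpace ℝ (Fin (n + 1)) → EuclideanSpace ℝ (Fin (n + 2))}
    {g : EuclideanSpace ℝ (Fin (n + 2)) → EuclideanSpace ℝ (Fin (n + 1))}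
    (hf : ∀ z, ‖z‖ = 1 → ContDiffAt ℝ ∞ f z) (hmem : ∀ z, ‖z‖ = 1 → f z ∈ zeroSet (n + 1))
    (hg : ∀ z, ‖z‖ = 1 → DifferentiableAt ℝ g (f z)) (hgf : ∀ z, ‖z‖ = 1 → g (f z) = z) :
    let _ := zeroSetChartedSpace n
    IsDiffeomorphicToSphere (m := n + 1) n
      ((Subtype.val : zeroSet (n + 1) → _) ⁻¹' (f '' Metric.sphere 0 1)) := by
  let _ := zeroSetChartedSpace n
  have := isManifold_zeroSet n
  have : Fact (Module.finrank ℝ (EuclideanSpace ℝ (Fin (n + 1))) = n + 1) :=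
    ⟨finrank_euclideanSpace_fin⟩
  have hnorm (z : Metric.sphere (0 : EuclideanSpace ℝ (Fin (n + 1))) 1) := norm_eq_of_mem_sphere z
  let φ (z : Metric.sphere (0 : EuclideanSpace ℝ (Fin (n + 1))) 1) : zeroSet (n + 1) :=
    ⟨f z, hmem z (hnorm z)⟩
  have hval : ContMDiff (𝓡 n) 𝓘(ℝ, EuclideanSpace ℝ (Fin (n + 2))) ∞ (Subtype.val ∘ φ) :=
    fun z ↦ (hf z (hnorm z)).contMDiffAt.comp z (contMDiff_coe_sphere z)
  have hφ : ContMDiff (𝓡 n) (𝓡 (n + 1)) ∞ φ :=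
    (ContMDiff.iff_comp_isImmersion (isSmoothEmbedding_zeroSet_val n).isImmersion).2
      ⟨hval.continuous.subtype_mk _, hval⟩
  have hcomp : (g ∘ Subtype.val) ∘ φ = Subtype.val := funext fun z ↦ hgf z (hnorm z)
  have hinj : Function.Injective φ :=
    Function.Injective.of_comp (f := g ∘ Subtype.val) (hcomp ▸ Subtype.val_injective)
  have hdφ (z) : Function.Injective (mfderiv (𝓡 n) (𝓡 (n + 1)) φ z) := by
    have hgz : MDifferentiableAt (𝓡 (n + 1)) 𝓘(ℝ, EuclideanSpace ℝ (Fin (n + 1)))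
        (g ∘ Subtype.val) (φ z) :=
      (hg z (hnorm z)).mdifferentiableAt.comp (φ z)
        (((isSmoothEmbedding_zeroSet_val n).contMDiff _).mdifferentiableAt (by simp))
    refine injective_mfderiv_of_comp hgz ((hφ z).mdifferentiableAt (by simp)) ?_
    rw [hcomp]
    exact injective_mvfderiv_subtypeVal_sphere z
  refine ⟨φ, isSmoothEmbedding_of_injective_mfderiv ℝ (by simp) (by simp) hφ hinj hdφ, ?_⟩
  ext x
  constructor
  · rintro ⟨z, rfl⟩
    exact ⟨z, z.2, rfl⟩
  · rintro ⟨z, hz, hzx⟩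
    exact ⟨⟨z, hz⟩, Subtype.ext hzx⟩

/-- The parametrization by the unit sphere of the hypersurface of revolution in the hyperplane
`x₁ = s` with axis coordinate `x₂ = d * r + c` and radius `ρ r * √(1 - r ^ 2)`. -/
def sphereMap (s c d : ℝ) (ρ : ℝ → ℝ) (z : EuclideanSpace ℝ (Fin (n + 1))) :
    EuclideanSpace ℝ (Fin (n + 2)) :=
  mkPoint s (d * z 0 + c) fun i ↦ ρ (z 0) * z i.succ

/-- The inverse of `sphereMap`, extended to all values of `x₁`. -/
def sphereInv (c d : ℝ) (ρ : ℝ → ℝ) (x : EuclideanSpace ℝ (Fin (n + 2))) :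
    EuclideanSpace ℝ (Fin (n + 1)) :=
  WithLp.toLp 2 (Fin.cons ((x 1 - c) / d) fun i ↦ x i.succ.succ / ρ ((x 1 - c) / d))

theorem contDiffAt_sphereMap {s c d : ℝ} {ρ : ℝ → ℝ} {z : EuclideanSpace ℝ (Fin (n + 1))}
    (hρ : ContDiffAt ℝ ∞ ρ (z 0)) : ContDiffAt ℝ ∞ (sphereMap s c d ρ) z := by
  have hcoord (j : Fin (n + 1)) :
      ContDiffAt ℝ ∞ (fun z : EuclideanSpace ℝ (Fin (n + 1)) ↦ z j) z := by fun_prop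
  rw [contDiffAt_euclidean]
  refine Fin.cases contDiffAt_const (Fin.cases ?_ fun i ↦ ?_)
  · exact (contDiffAt_const.mul (hcoord 0)).add contDiffAt_const
  · exact (hρ.comp z (hcoord 0)).mul (hcoord i.succ)

theorem differentiableAt_sphereInv {c d : ℝ} {ρ : ℝ → ℝ} {x : EuclideanSpace ℝ (Fin (n + 2))}
    (hρ : DifferentiableAt ℝ ρ ((x 1 - c) / d)) (hρ0 : ρ ((x 1 - c) / d) ≠ 0) :
    DifferentiableAt ℝ (sphereInv c d ρ) x := by
  have hcoord : DifferentiableAt ℝ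
      (fun x : EuclideanSpace ℝ (Fin (n + 2)) ↦ (x 1 - c) / d) x := by fun_prop
  rw [differentiableAt_euclidean]
  refine Fin.cases hcoord fun i ↦ ?_
  have hdiv : DifferentiableAt ℝ
      (fun x : EuclideanSpace ℝ (Fin (n + 2)) ↦ x i.succ.succ / ρ ((x 1 - c) / d)) x := by
    fun_prop (disch := assumption)
  exact hdiv

theorem sphereInv_sphereMap {s c d : ℝ} (hd : d ≠ 0) {ρ : ℝ → ℝ}
    {z : EuclideanSpace ℝ (Fin (n + 1))} (hρ : ρ (z 0) ≠ 0) :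
    sphereInv c d ρ (sphereMap s c d ρ z) = z := by
  have h0 : (d * z 0 + c - c) / d = z 0 := by field_simp; ring
  ext j
  refine Fin.cases h0 (fun i ↦ ?_) j
  change ρ (z 0) * z i.succ / ρ ((d * z 0 + c - c) / d) = z i.succ
  rw [h0, mul_div_cancel_left₀ _ hρ]

theorem sphereMap_sphereInv {c d : ℝ} (hd : d ≠ 0) {ρ : ℝ → ℝ}
    {x : EuclideanSpace ℝ (Fin (n + 2))} (hρ : ρ ((x 1 - c) / d) ≠ 0) :
    sphereMap (x 0) c d ρ (sphereInv c d ρ x) = x := by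
  refine (eq_mkPoint_iff.2 ⟨rfl, ?_, fun i ↦ (mul_div_cancel₀ _ hρ).symm⟩).symm
  change x 1 = d * ((x 1 - c) / d) + c
  field_simp
  ring

theorem norm_eq_one_iff_fin_succ (z : EuclideanSpace ℝ (Fin (n + 1))) :
    ‖z‖ = 1 ↔ ∑ i : Fin n, z i.succ ^ 2 = 1 - z 0 ^ 2 := by
  rw [EuclideanSpace.norm_eq, Real.sqrt_eq_one, Fin.sum_univ_succ, eq_sub_iff_add_eq']
  simp only [Real.norm_eq_abs, sq_abs]

theorem apply_mem_Icc_of_norm_eq_one {z : EuclideanSpace ℝ (Fin (n + 1))} (hz : ‖z‖ = 1)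
    (j : Fin (n + 1)) : z j ∈ Icc (-1 : ℝ) 1 :=
  abs_le.1 (hz ▸ PiLp.norm_apply_le z j)

theorem sphereMap_mem_zeroSet_iff {s c d : ℝ} {ρ : ℝ → ℝ} {z : EuclideanSpace ℝ (Fin (n + 1))}
    (hρ : ρ (z 0) ≠ 0) (hr : radiusSq s (d * z 0 + c) = ρ (z 0) ^ 2 * (1 - z 0 ^ 2)) :
    sphereMap s c d ρ z ∈ zeroSet (n + 1) ↔ ‖z‖ = 1 := by
  simp only [sphereMap, mkPoint_mem_zeroSet_iff, hr, mul_pow, ← Finset.mul_sum]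
  rw [mul_right_inj' (pow_ne_zero 2 hρ), norm_eq_one_iff_fin_succ]

theorem analyticOnNhd_radiusSq (s : ℝ) : AnalyticOnNhd ℝ (radiusSq s) univ := by
  intro t _
  unfold radiusSq
  fun_prop

theorem exists_fiber_eq_Icc_of_deriv_ne_zero {s y : ℝ} (hne : (fiber s y).Nonempty)
    (hd : ∀ t ∈ fiber s y, radiusSq s t = 0 → deriv (radiusSq s) t ≠ 0) :
    ∃ a b, a < b ∧ fiber s y = Icc a b ∧ radiusSq s a = 0 ∧ radiusSq s b = 0 ∧
      ∀ t ∈ Ioo a b, 0 < radiusSq s t := by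
  obtain ⟨a, b, hab, hI, ha, hb⟩ := exists_fiber_eq_Icc hne
  rw [hI] at hd
  have hnonneg : ∀ t ∈ Icc a b, 0 ≤ radiusSq s t := fun t ht ↦
    radiusSq_nonneg_iff.2 (hI.superset ht).1
  refine ⟨a, b, hab.lt_of_ne ?_, hI, ha, hb, fun t ht ↦ ?_⟩
  · rintro rfl
    rw [Icc_self] at hI hd
    obtain ⟨u, hua, hu⟩ := exists_uIcc_nonneg_of_deriv_ne_zero ha (hd a rfl ha)
    refine hua (hI.subset (mem_fiber_of_forall_mem_region (hI.superset rfl) fun t ht ↦ ?_))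
    exact radiusSq_nonneg_iff.1 (hu t ht)
  · have htI := Ioo_subset_Icc_self ht
    refine (hnonneg t htI).lt_of_ne' fun h0 ↦ hd t htI h0 (IsLocalMin.deriv_eq_zero ?_)
    filter_upwards [Icc_mem_nhds ht.1 ht.2] with u hu
    exact h0 ▸ hnonneg u hu

theorem exists_fiber_eq_image_and_radiusSq_eq {s y : ℝ} (hne : (fiber s y).Nonempty)
    (hder : ∀ t ∈ fiber s y, radiusSq s t = 0 → deriv (radiusSq s) t ≠ 0) :
    ∃ (c d : ℝ) (ρ : ℝ → ℝ), 0 < d ∧ fiber s y = (d * · + c) '' Icc (-1) 1 ∧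
      ∀ r ∈ Icc (-1) 1, ContDiffAt ℝ ∞ ρ r ∧ 0 < ρ r ∧
        radiusSq s (d * r + c) = ρ r ^ 2 * (1 - r ^ 2) := by
  obtain ⟨a, b, hab, hI, ha, hb, hpos⟩ := exists_fiber_eq_Icc_of_deriv_ne_zero hne hder
  rw [hI] at hder
  obtain ⟨k, hk, hfac⟩ := exists_eq_mul_of_zeros (analyticOnNhd_radiusSq s) hab.ne ha hb
  have hk' : ContDiff ℝ ∞ k := hk.contDiff
  have hkpos : ∀ t ∈ Icc a b, 0 < k t := fun t ↦
    pos_of_eq_mul_of_deriv_ne_zero (hk'.differentiable (by simp)) hab hfac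
      (hder a (left_mem_Icc.2 hab.le) ha) (hder b (right_mem_Icc.2 hab.le) hb) hpos
  set d := (b - a) / 2
  set c := (a + b) / 2
  have hd0 : 0 < d := half_pos (sub_pos.2 hab)
  have himage : (d * · + c) '' Icc (-1) 1 = Icc a b := by
    rw [image_affine_Icc' hd0]
    congr 1 <;> ring
  refine ⟨c, d, fun r ↦ d * √(k (d * r + c)), hd0, hI.trans himage.symm, fun r hr ↦ ?_⟩
  have hkr : 0 < k (d * r + c) := hkpos _ (himage.subset (mem_image_of_mem _ hr))
  refine ⟨?_, mul_pos hd0 (Real.sqrt_pos.2 hkr), ?_⟩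
  · have hkd : ContDiffAt ℝ ∞ (fun r ↦ k (d * r + c)) r := by fun_prop
    exact contDiffAt_const.mul (hkd.sqrt hkr.ne')
  · rw [hfac, mul_pow, Real.sq_sqrt hkr.le]
    ring

theorem contour_eq_preimage_image_sphereMap (hn : 0 < n) (x : zeroSet (n + 1)) {c d : ℝ}
    {ρ : ℝ → ℝ} (hd : d ≠ 0)
    (hI : fiber (x.1 0) (label (x.1 0) (x.1 1)) = (d * · + c) '' Icc (-1) 1)
    (hρ : ∀ r ∈ Icc (-1) 1, 0 < ρ r)
    (hr : ∀ r ∈ Icc (-1) 1, radiusSq (x.1 0) (d * r + c) = ρ r ^ 2 * (1 - r ^ 2)) :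
    contour (firstCoord (n + 1)) x =
      Subtype.val ⁻¹' (sphereMap (x.1 0) c d ρ '' Metric.sphere 0 1) := by
  ext y
  rw [mem_contour_iff hn, toTree_eq_iff, hI, mem_preimage]
  constructor
  · rintro ⟨h0, r, hr1, hry⟩
    obtain rfl : (y.1 1 - c) / d = r := by
      rw [← hry]
      field_simp
      ring
    have hy := sphereMap_sphereInv hd (hρ _ hr1).ne'
    rw [h0] at hy
    refine ⟨sphereInv c d ρ y, ?_, hy⟩
    rw [mem_sphere_zero_iff_norm, ← sphereMap_mem_zeroSet_iff (hρ _ hr1).ne' (hr _ hr1), hy]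
    exact y.2
  · rintro ⟨z, hz, hzy⟩
    rw [← hzy]
    exact ⟨rfl, z 0, apply_mem_Icc_of_norm_eq_one (mem_sphere_zero_iff_norm.1 hz) 0, rfl⟩

theorem deriv_radiusSq_ne_zero_of_isRegularSet (hn : 0 < n) (x : zeroSet (n + 1))
    (hreg : let _ := zeroSetChartedSpace n
      IsRegularSet (m := n + 1) (firstCoord (n + 1)) (contour (firstCoord (n + 1)) x))
    {t : ℝ} (ht : t ∈ fiber (x.1 0) (label (x.1 0) (x.1 1))) (h0 : radiusSq (x.1 0) t = 0) :
    deriv (radiusSq (x.1 0)) t ≠ 0 := fun hd ↦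
  hreg ⟨mkPoint (x.1 0) t 0, mkPoint_zero_mem_zeroSet h0⟩
    ((mem_contour_iff hn).2 (toTree_eq_iff.2 ⟨rfl, ht⟩)) ((mem_criticalPoints_iff _).2 ⟨h0, hd⟩)

theorem isDiffeomorphicToSphere_contour (hn : 0 < n) (x : zeroSet (n + 1))
    (hreg : let _ := zeroSetChartedSpace n
      IsRegularSet (m := n + 1) (firstCoord (n + 1)) (contour (firstCoord (n + 1)) x)) :
    let _ := zeroSetChartedSpace n
    IsDiffeomorphicToSphere (m := n + 1) n (contour (firstCoord (n + 1)) x) := by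
  obtain ⟨c, d, ρ, hd, hI, hρ⟩ := exists_fiber_eq_image_and_radiusSq_eq
    ⟨x.1 1, (toTree_eq_iff.1 (rfl : toTree x = toTree x)).2⟩
    fun t ↦ deriv_radiusSq_ne_zero_of_isRegularSet hn x hreg
  rw [contour_eq_preimage_image_sphereMap hn x hd.ne' hI (fun r hr ↦ (hρ r hr).2.1)
    fun r hr ↦ (hρ r hr).2.2]
  have hz0 (z : EuclideanSpace ℝ (Fin (n + 1))) (hz : ‖z‖ = 1) :=
    hρ (z 0) (apply_mem_Icc_of_norm_eq_one hz 0)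
  have hinv (z : EuclideanSpace ℝ (Fin (n + 1))) : (d * z 0 + c - c) / d = z 0 := by
    field_simp
    ring
  refine isDiffeomorphicToSphere_of_leftInverse (g := sphereInv c d ρ) (fun z hz ↦ ?_)
    (fun z hz ↦ ?_) (fun z hz ↦ ?_) fun z hz ↦ ?_
  · exact contDiffAt_sphereMap (hz0 z hz).1
  · exact (sphereMap_mem_zeroSet_iff (hz0 z hz).2.1.ne' (hz0 z hz).2.2).2 hz
  · refine differentiableAt_sphereInv ?_ ?_
    · change DifferentiableAt ℝ ρ ((d * z 0 + c - c) / d)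
      rw [hinv z]
      exact (hz0 z hz).1.differentiableAt (by simp)
    · change ρ ((d * z 0 + c - c) / d) ≠ 0
      rw [hinv z]
      exact (hz0 z hz).2.1.ne'
  · exact sphereInv_sphereMap hd.ne' (hz0 z hz).2.1.ne'

theorem connectedSpace_tree : ConnectedSpace tree := by
  have := isConnected_iff_connectedSpace.1 (isConnected_zeroSet one_pos)
  exact (surjective_toTree one_pos).connectedSpace (continuous_toTree (n := 1))

end RegularContours

end Reeb

end

theorem theorem1 :
    ∃ (G : Type) (_ : TopologicalSpace G) (_ : CWComplex (univ : Set G)),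
      ConnectedSpace G ∧ Reeb.IsInfiniteGraph G ∧
      ∀ m : ℕ, 1 < m →
        AnalyticOnNhd ℝ (Reeb.definingFun m) univ ∧
        IsConnected (Reeb.zeroSet m) ∧
        ¬ IsCompact (Reeb.zeroSet m) ∧
        ∃ _ : ChartedSpace (EuclideanSpace ℝ (Fin m)) (Reeb.zeroSet m),
          IsManifold (𝓡 m) ∞ (Reeb.zeroSet m) ∧
          IsSmoothEmbedding (𝓡 m) 𝓘(ℝ, EuclideanSpace ℝ (Fin (m + 1))) ∞
            (Subtype.val : Reeb.zeroSet m → EuclideanSpace ℝ (Fin (m + 1))) ∧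
          ContMDiff (𝓡 m) 𝓘(ℝ, ℝ) ∞ (Reeb.firstCoord m) ∧
          (∃ _ : CWComplex (univ : Set (Reeb.ReebSpace (Reeb.firstCoord m))),
            Reeb.IsReebGraph (m := m) (Reeb.firstCoord m) ∧
            Reeb.GraphIsomorphic G (Reeb.ReebSpace (Reeb.firstCoord m))) ∧
          (∀ K : Set (Reeb.ReebSpace (Reeb.firstCoord m)), IsCompact K →
            IsCompact (Reeb.quotientMap (Reeb.firstCoord m) ⁻¹' K)) ∧
          (∀ x : Reeb.zeroSet m,
            Reeb.IsRegularSet (m := m) (Reeb.firstCoord m)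
              (Reeb.contour (Reeb.firstCoord m) x) →
            Reeb.IsDiffeomorphicToSphere (m := m) (m - 1)
              (Reeb.contour (Reeb.firstCoord m) x)) := by
  refine ⟨Reeb.tree, inferInstance, Reeb.treeGraph.cwComplex, Reeb.connectedSpace_tree,
    Reeb.treeGraph.isInfiniteGraph, fun m hm ↦ ?_⟩
  obtain ⟨n, rfl⟩ : ∃ n, m = n + 1 := ⟨m - 1, by omega⟩
  have hn : 0 < n := by omega
  let _ := Reeb.zeroSetChartedSpace n
  have := (Reeb.reebHomeomorph hn).t2Space
  let D := Reeb.treeGraph.map (Reeb.reebHomeomorph hn)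
  have : Nonempty D.ι := inferInstanceAs (Nonempty Reeb.treeGraph.ι)
  let _ := D.cwComplex
  exact ⟨Reeb.analyticOnNhd_definingFun (n + 1), Reeb.isConnected_zeroSet hn,
    Reeb.not_isCompact_zeroSet, Reeb.zeroSetChartedSpace n, Reeb.isManifold_zeroSet n,
    Reeb.isSmoothEmbedding_zeroSet_val n, Reeb.contMDiff_firstCoord n,
    ⟨D.cwComplex,
      ⟨D.isGraph, D.vertexSet_eq.trans (Reeb.image_quotientMap_criticalPoints hn).symm⟩,
      Reeb.treeGraph.graphIsomorphic_map (Reeb.reebHomeomorph hn)⟩,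
    fun K hK ↦ Reeb.isCompact_preimage_quotientMap hn hK,
    fun x hx ↦ Reeb.isDiffeomorphicToSphere_contour hn x hx⟩
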